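/- Let $n\ge 2$ and $X_n=\{0,\dots,n-1\}$. For $m\ge 1$ and $f:X_n^m\to X_n$ let $f_\infty:X_n^{\mathbb Z}\to X_n^{\mathbb Z}$ be the map $x\mapsto y$ with $y_i=f(x_{i-m+1}\dots x_i)$. Call $f$ right permutive if, for every block $a\in X_n^{m-1}$, the map $x\mapsto f(ax)$ is a permutation of $X_n$. Let $RF_\infty(X_n)$ be the set of all $f_\infty$ with $f$ right permutive ($m\ge1$ arbitrary); it is a monoid under composition of maps, where the product of $f_\infty$ and $g_\infty$ is "first $f_\infty$, then $g_\infty$". A transducer $T$ over $X_n$ consists of a finite set $Q_T$ of states, a transition function $\pi_T:X_n\times Q_T\to Q_T$ and an output function $\lambda_T:X_n\times Q_T\to X_n$. Each state $q$ induces a map $T_q:X_n^{\mathbb N}\to X_n^{\mathbb N}$ (read an infinite word letter by letter, starting in state $q$). Two states are $\omega$-equivalent if they induce the same map; $T$ is weakly minimal if distinct states are never $\omega$-equivalent; weakly minimal transducers $T,U$ are identified ($\omega$-equal) if there is a bijection $\phi:Q_T\to Q_U$ such that $T_q$ and $U_{\phi(q)}$ induce the same map for all $q$. $T$ is strongly synchronizing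 if for some $k$ the state reached after reading any word of length $k$ depends only on the word and not on the initial state; its core is the set of states reached in this way, and $T$ is core if all its states are in the core. The weakly minimal, core, strongly synchronizing transducers (up to $\omega$-equality) form a monoid: the product of $T$ and $U$ is obtained from the transducer with states $Q_T\times Q_U$, $\pi(x,(p,q))=(\pi_T(x,p),\pi_U(\lambda_T(x,p),q))$, $\lambda(x,(p,q))=\lambda_U(\lambda_T(x,p),q)$, by removing the states outside the core and identifying $\omega$-equivalent states. Let $\mathcal{SH}_n$ be the submonoid of those transducers all of whose states induce homeomorphisms of $X_n^{\mathbb N}$. $T$ is invertible if $\lambda_T(\cdot,q)$ is a permutation of $X_n$ for every state $q$; then $T^{-1}$ is the transducer obtained by exchanging inputs and outputs on all transitions, and $T$ is bi-synchronizing if $T$ and $T^{-1}$ are both strongly synchronizing. Let $\mathcal H_n$ be the set of weakly minimal, core, bi-synchronizing transducers (up to $\omega$-equality); it is a group contained in $\mathcal{SH}_n$. Let $\mathrm{Aut}(X_n^{-\mathbb N},\sigma_n)$ be the group of homeomorphisms of $X_n^{-\mathbb N}$ (the sequences $\dots x_{-2}x_{-1}x_0$) that commute with the shift $\sigma_n$,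 $(x\sigma_n)_i=x_{i-1}$. For $r\ge1$ let $G_{n,r}$ be the Higman–Thompson group, i.e. the group of homeomorphisms of the disjoint union of $r$ copies of $X_n^{\mathbb N}$ that are given by a finite table of prefix replacements, and let $\mathrm{Out}(G_{n,r})$ be its outer automorphism group. Theorem. (1) The monoids $RF_\infty(X_n)$ and $\mathcal{SH}_n$ are isomorphic. (2) The groups $\mathrm{Aut}(X_n^{-\mathbb N},\sigma_n)$ and $\mathcal H_n$ are isomorphic. (3) For every $r$ with $1\le r<n$, the group $\mathrm{Aut}(X_n^{-\mathbb N},\sigma_n)$ is isomorphic to a subgroup of $\mathrm{Out}(G_{n,r})$. -/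

import Mathlib

/-! ### Synchronous transducers over the alphabet `{0, …, n - 1}` -/

/-- A finite, synchronous, non-initial transducer over `X_n = Fin n`: reading the letter `x` in the
state `q`, it writes the letter `out x q` and moves to the state `trans x q`. -/
structure Transducer (n : ℕ) where
  /-- the set of states -/
  Q : Type
  finite_Q : Finite Q
  /-- the transition function -/
  trans : Fin n → Q → Q
  /-- the output function -/
  out : Fin n → Q → Fin n

namespace Transducer

variable {n : ℕ}

/-- The final state after reading the finite word `w` from the state `q`. -/
def run (T : Transducer n) : List (Fin n) → T.Q → T.Q
  | [], q => q
  | x :: w, q => T.run w (T.trans x q)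

/-- The word written while reading the finite word `w` from the state `q`. -/
def outWord (T : Transducer n) : List (Fin n) → T.Q → List (Fin n)
  | [], _ => []
  | x :: w, q => T.out x q :: T.outWord w (T.trans x q)

/-- The state in which the letter `x i` of the infinite word `x` is read, when starting in `q`. -/
def stateAt (T : Transducer n) (q : T.Q) (x : ℕ → Fin n) : ℕ → T.Q
  | 0 => q
  | i + 1 => T.trans (x i) (T.stateAt q x i)

/-- The map of `X_n^ℕ` to itself induced by the initial transducer `T_q`. -/
def act (T : Transducer n) (q : T.Q) (x : ℕ → Fin n) : ℕ → Fin n :=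
  fun i => T.out (x i) (T.stateAt q x i)

/-- `s` is a synchronizing map at level `k`: reading a word `w` of length `k` leads to the state
`s w`, whatever the initial state. -/
def IsSyncMap (T : Transducer n) (k : ℕ) (s : List.Vector (Fin n) k → T.Q) : Prop :=
  ∀ (w : List.Vector (Fin n) k) (q : T.Q), T.run w.toList q = s w

/-- `T` is synchronizing at level `k`. -/
def SyncAt (T : Transducer n) (k : ℕ) : Prop :=
  ∃ s, T.IsSyncMap k s

/-- `T` is strongly synchronizing. -/
def StronglySync (T : Transducer n) : Prop :=
  ∃ k, T.SyncAt k

/-- The set of core states: the image of a synchronizing map (for `n ≥ 1` the image does not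
depend on the level). -/
def coreSet (T : Transducer n) : Set T.Q :=
  {q | ∃ k s, T.IsSyncMap k s ∧ q ∈ Set.range s}

/-- `T` is strongly synchronizing and equal to its core. -/
def IsCore (T : Transducer n) : Prop :=
  T.StronglySync ∧ T.coreSet = Set.univ

/-- No two distinct states of `T` are `ω`-equivalent, i.e. induce the same map of `X_n^ℕ`. -/
def WeaklyMinimal (T : Transducer n) : Prop :=
  ∀ p q : T.Q, T.act p = T.act q → p = q

/-- `ω`-equality of (weakly minimal) non-initial transducers. -/
def OmegaEqual (T U : Transducer n) : Prop :=
  ∃ f : T.Q ≃ U.Q, ∀ q, T.act q = U.act (f q)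

/-- The product `T * U`: the output of `T` becomes the input of `U`. -/
abbrev prod (T U : Transducer n) : Transducer n where
  Q := T.Q × U.Q
  finite_Q := by
    have := T.finite_Q
    have := U.finite_Q
    infer_instance
  trans x p := (T.trans x p.1, U.trans (T.out x p.1) p.2)
  out x p := U.out (T.out x p.1) p.2

/-- The identity transducer, with a single state. -/
abbrev one (n : ℕ) : Transducer n where
  Q := Unit
  finite_Q := inferInstance
  trans _ q := q
  out x _ := x

/-- `T` is invertible (in the sense of automata theory): every state permutes the letters. -/
def Invertible (T : Transducer n) : Prop :=
  ∀ q, Function.Bijective (fun x => T.out x q)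

/-- The permutation `ρ_q` of the alphabet given by a state of an invertible transducer. -/
noncomputable def perm (T : Transducer n) (h : T.Invertible) (q : T.Q) : Equiv.Perm (Fin n) :=
  Equiv.ofBijective (fun x => T.out x q) (h q)

/-- The inverse transducer `T⁻¹`: inputs and outputs are exchanged on all transitions. -/
noncomputable abbrev inv (T : Transducer n) (h : T.Invertible) : Transducer n where
  Q := T.Q
  finite_Q := T.finite_Q
  trans x q := T.trans ((T.perm h q).symm x) q
  out x q := (T.perm h q).symm x

/-! #### Basic facts, and the core and the weak minimization -/

/-- The infinite word `a x`. -/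
def consSeq (a : Fin n) (x : ℕ → Fin n) : ℕ → Fin n
  | 0 => a
  | i + 1 => x i

theorem stateAt_cons (T : Transducer n) (q : T.Q) (a : Fin n) (x : ℕ → Fin n) (i : ℕ) :
    T.stateAt q (consSeq a x) (i + 1) = T.stateAt (T.trans a q) x i := by
  induction i with
  | zero => rfl
  | succ i ih => rw [stateAt, ih]; rfl

theorem act_trans_congr {T U : Transducer n} {a : T.Q} {b : U.Q} (h : T.act a = U.act b)
    (x : Fin n) : T.act (T.trans x a) = U.act (U.trans x b) := by
  funext y i
  have := congrFun (congrFun h (consSeq x y)) (i + 1)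
  simpa only [act, stateAt_cons, consSeq] using this

theorem act_run_congr {T U : Transducer n} (w : List (Fin n)) : ∀ {a : T.Q} {b : U.Q},
    T.act a = U.act b → T.act (T.run w a) = U.act (U.run w b) := by
  induction w with
  | nil => intro a b h; exact h
  | cons x w ih => intro a b h; exact ih (act_trans_congr h x)

theorem out_eq_act (T : Transducer n) (x : Fin n) (q : T.Q) : T.out x q = T.act q (fun _ => x) 0 :=
  rfl

theorem run_append (T : Transducer n) (v w : List (Fin n)) :
    ∀ q, T.run (v ++ w) q = T.run w (T.run v q) := by
  induction v with
  | nil => intro q; rfl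
  | cons x v ih => intro q; exact ih _

theorem length_outWord (T : Transducer n) (w : List (Fin n)) :
    ∀ q, (T.outWord w q).length = w.length := by
  induction w with
  | nil => intro q; rfl
  | cons x w ih => intro q; simp [outWord, ih]

theorem isSyncMap_succ {T : Transducer n} {k : ℕ} {s} (h : T.IsSyncMap k s) :
    T.IsSyncMap (k + 1) (fun w => s w.tail) := by
  intro w q
  obtain ⟨l, hl⟩ := w
  match l, hl with
  | x :: l, hl => exact h ⟨l, by simpa using hl⟩ (T.trans x q)

theorem trans_mem_coreSet {T : Transducer n} (x : Fin n) {q : T.Q} (h : q ∈ T.coreSet) :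
    T.trans x q ∈ T.coreSet := by
  obtain ⟨k, s, hs, ⟨⟨w, hw⟩, rfl⟩⟩ := h
  let v : List.Vector (Fin n) (k + 1) := ⟨w ++ [x], by simp [hw]⟩
  refine ⟨k + 1, _, isSyncMap_succ hs, v, ?_⟩
  have h1 := isSyncMap_succ hs v (s ⟨w, hw⟩)
  have h2 : T.run w (s ⟨w, hw⟩) = s ⟨w, hw⟩ := hs ⟨w, hw⟩ (s ⟨w, hw⟩)
  have h3 : T.run v.toList (s ⟨w, hw⟩) = T.trans x (T.run w (s ⟨w, hw⟩)) := run_append _ _ _ _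
  exact h1.symm.trans (h3.trans (by rw [h2]))

/-- The core of `T`, as a transducer. -/
abbrev core (T : Transducer n) : Transducer n where
  Q := T.coreSet
  finite_Q := by
    have := T.finite_Q
    infer_instance
  trans x q := ⟨T.trans x q.1, trans_mem_coreSet x q.2⟩
  out x q := T.out x q.1

/-- `ω`-equivalence of states. -/
def stateSetoid (T : Transducer n) : Setoid T.Q := Setoid.ker T.act

/-- The weakly minimal transducer obtained from `T` by identifying `ω`-equivalent states. -/
abbrev wmin (T : Transducer n) : Transducer n where
  Q := Quotient T.stateSetoid
  finite_Q := by
    have := T.finite_Q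
    infer_instance
  trans x := Quotient.map (T.trans x) (fun _ _ h => act_trans_congr (T := T) (U := T) h x)
  out x := Quotient.lift (T.out x) (fun a b (h : T.act a = T.act b) => by
    rw [out_eq_act, out_eq_act, h])

theorem stateAt_hom {T U : Transducer n} (f : T.Q → U.Q)
    (hf : ∀ x q, f (T.trans x q) = U.trans x (f q)) (q : T.Q) (x : ℕ → Fin n) (i : ℕ) :
    U.stateAt (f q) x i = f (T.stateAt q x i) := by
  induction i with
  | zero => rfl
  | succ i ih => rw [stateAt, ih, ← hf]; rfl

theorem run_hom {T U : Transducer n} (f : T.Q → U.Q)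
    (hf : ∀ x q, f (T.trans x q) = U.trans x (f q)) (w : List (Fin n)) :
    ∀ q, U.run w (f q) = f (T.run w q) := by
  induction w with
  | nil => intro q; rfl
  | cons x w ih => intro q; rw [run, ← hf, ih]; rfl

theorem act_core (T : Transducer n) (q : T.core.Q) : T.core.act q = T.act q.1 := by
  funext x i
  have h := stateAt_hom (T := T.core) (U := T) Subtype.val (fun _ _ => rfl) q x i
  change T.out _ _ = T.out _ _
  rw [h]

theorem act_wmin (T : Transducer n) (q : T.Q) :
    T.wmin.act (Quotient.mk T.stateSetoid q) = T.act q := by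
  funext x i
  have h := stateAt_hom (T := T) (U := T.wmin) (Quotient.mk T.stateSetoid) (fun _ _ => rfl) q x i
  change T.wmin.out _ _ = T.out _ _
  rw [h]
  rfl

theorem wmin_weaklyMinimal (T : Transducer n) : T.wmin.WeaklyMinimal := by
  intro p q h
  induction p using Quotient.inductionOn with | _ p =>
  induction q using Quotient.inductionOn with | _ q =>
  rw [act_wmin, act_wmin] at h
  exact Quotient.sound h

theorem stateAt_prod (T U : Transducer n) (p : T.Q) (q : U.Q) (x : ℕ → Fin n) (i : ℕ) :
    (T.prod U).stateAt (p, q) x i = (T.stateAt p x i, U.stateAt q (T.act p x) i) := by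
  induction i with
  | zero => rfl
  | succ i ih => rw [stateAt, ih]; rfl

theorem act_prod (T U : Transducer n) (p : T.Q) (q : U.Q) :
    (T.prod U).act (p, q) = U.act q ∘ T.act p := by
  funext x i
  change (T.prod U).out _ _ = _
  rw [stateAt_prod]
  rfl

theorem run_prod (T U : Transducer n) (w : List (Fin n)) : ∀ (p : T.Q) (q : U.Q),
    (T.prod U).run w (p, q) = (T.run w p, U.run (T.outWord w p) q) := by
  induction w with
  | nil => intro p q; rfl
  | cons x w ih => intro p q; exact ih _ _

theorem act_one (q : (one n).Q) : (one n).act q = id := rfl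

/-- Synchronization at a level, in terms of pairs of states. -/
theorem syncAt_of_forall {T : Transducer n} [hT : Nonempty T.Q] {k : ℕ}
    (h : ∀ w : List (Fin n), w.length = k → ∀ p q, T.run w p = T.run w q) : T.SyncAt k := by
  obtain ⟨q₀⟩ := hT
  exact ⟨fun w => T.run w.toList q₀, fun w q => h _ w.2 _ _⟩

theorem SyncAt.run_eq {T : Transducer n} {k : ℕ} (h : T.SyncAt k) (w : List (Fin n))
    (hw : w.length = k) (p q : T.Q) : T.run w p = T.run w q := by
  obtain ⟨s, hs⟩ := h
  exact (hs ⟨w, hw⟩ p).trans (hs ⟨w, hw⟩ q).symm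

theorem SyncAt.mono {T : Transducer n} {k l : ℕ} (h : T.SyncAt k) (hl : k ≤ l) : T.SyncAt l := by
  induction l, hl using Nat.le_induction with
  | base => exact h
  | succ l _ ih => obtain ⟨s, hs⟩ := ih; exact ⟨_, isSyncMap_succ hs⟩

theorem SyncAt.core {T : Transducer n} {k : ℕ} (h : T.SyncAt k) : T.core.SyncAt k := by
  obtain ⟨s, hs⟩ := h
  refine ⟨fun w => ⟨s w, k, s, hs, w, rfl⟩, fun w q => ?_⟩
  apply Subtype.ext
  exact (run_hom (T := T.core) (U := T) Subtype.val (fun _ _ => rfl) _ q).symm.trans (hs w q.1)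

theorem StronglySync.isCore_core {T : Transducer n} (h : T.StronglySync) : T.core.IsCore := by
  obtain ⟨k, hk⟩ := h
  refine ⟨⟨k, hk.core⟩, Set.eq_univ_of_forall ?_⟩
  rintro ⟨q, k, s, hs, w, rfl⟩
  obtain ⟨s', hs'⟩ := SyncAt.core ⟨s, hs⟩
  refine ⟨k, s', hs', w, ?_⟩
  rw [← hs' w ⟨s w, k, s, hs, w, rfl⟩]
  apply Subtype.ext
  exact (run_hom (T := T.core) (U := T) Subtype.val (fun _ _ => rfl) _ _).symm.trans (hs w _)

theorem isCore_of_surjective {T U : Transducer n} (f : T.Q → U.Q)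
    (hf : ∀ x q, f (T.trans x q) = U.trans x (f q)) (hs : Function.Surjective f)
    (h : T.IsCore) : U.IsCore := by
  have key : ∀ k s, T.IsSyncMap k s → U.IsSyncMap k (f ∘ s) := by
    intro k s h w q
    obtain ⟨q, rfl⟩ := hs q
    rw [run_hom f hf, h]
    rfl
  obtain ⟨⟨k, s, hk⟩, hc⟩ := h
  refine ⟨⟨k, _, key k s hk⟩, Set.eq_univ_of_forall fun q => ?_⟩
  obtain ⟨q, rfl⟩ := hs q
  obtain ⟨k, s, hs, w, rfl⟩ := hc.ge (Set.mem_univ q)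
  exact ⟨k, _, key k s hs, w, rfl⟩

theorem IsCore.wmin {T : Transducer n} (h : T.IsCore) : T.wmin.IsCore :=
  isCore_of_surjective (U := T.wmin) (Quotient.mk T.stateSetoid) (fun _ _ => rfl)
    Quotient.mk_surjective h

theorem stronglySync_of_injective {T U : Transducer n} [Nonempty T.Q] (f : T.Q → U.Q)
    (hf : ∀ x q, f (T.trans x q) = U.trans x (f q)) (hi : Function.Injective f)
    (h : U.StronglySync) : T.StronglySync := by
  obtain ⟨k, hk⟩ := h
  refine ⟨k, syncAt_of_forall fun w hw p q => hi ?_⟩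
  rw [← run_hom f hf, ← run_hom f hf, hk.run_eq w hw]

theorem stronglySync_of_surjective {T U : Transducer n} (f : T.Q → U.Q)
    (hf : ∀ x q, f (T.trans x q) = U.trans x (f q)) (hs : Function.Surjective f)
    (h : T.StronglySync) : U.StronglySync := by
  obtain ⟨k, s, h⟩ := h
  refine ⟨k, f ∘ s, fun w q => ?_⟩
  obtain ⟨q, rfl⟩ := hs q
  rw [run_hom f hf, h]
  rfl

theorem one_isCore (n : ℕ) : (one n).IsCore := by
  have h : (one n).IsSyncMap 0 (fun _ => ()) := fun _ _ => rfl
  exact ⟨⟨0, _, h⟩, Set.eq_univ_of_forall fun q => ⟨0, _, h, List.Vector.nil, rfl⟩⟩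

theorem one_weaklyMinimal (n : ℕ) : (one n).WeaklyMinimal := fun _ _ _ => rfl

theorem omegaEqual_of_range_eq {T U : Transducer n} (hT : T.WeaklyMinimal) (hU : U.WeaklyMinimal)
    (h : Set.range T.act = Set.range U.act) : T.OmegaEqual U := by
  refine ⟨(Equiv.ofInjective T.act hT).trans
    ((Equiv.setCongr h).trans (Equiv.ofInjective U.act hU).symm), fun q => ?_⟩
  have := Equiv.apply_ofInjective_symm hU ((Equiv.setCongr h) (Equiv.ofInjective T.act hT q))
  exact this.symm

theorem range_act_wmin (T : Transducer n) : Set.range T.wmin.act = Set.range T.act := by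
  ext g
  constructor
  · rintro ⟨q, rfl⟩
    induction q using Quotient.inductionOn with | _ q =>
    exact ⟨q, (act_wmin T q).symm⟩
  · rintro ⟨q, rfl⟩
    exact ⟨_, act_wmin T q⟩

/-! #### Facts that need a non-empty alphabet -/

variable [n.AtLeastTwo]

theorem StronglySync.nonempty {T : Transducer n} (h : T.StronglySync) : Nonempty T.Q := by
  obtain ⟨k, s, _⟩ := h
  exact ⟨s (List.Vector.replicate k 0)⟩


theorem run_mem_coreSet {n : ℕ} {T : Transducer n} (w : List (Fin n)) (h : T.SyncAt w.length) (q : T.Q) :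
    T.run w q ∈ T.coreSet := by
  obtain ⟨s, hs⟩ := h
  exact ⟨_, s, hs, ⟨w, rfl⟩, (hs ⟨w, rfl⟩ q).symm⟩

theorem exists_word_of_mem_coreSet {T : Transducer n} {q : T.Q} (h : q ∈ T.coreSet) (l : ℕ) :
    ∃ w : List (Fin n), l ≤ w.length ∧ ∀ p, T.run w p = q := by
  obtain ⟨k, s, hs, w, rfl⟩ := h
  refine ⟨List.replicate l 0 ++ w.toList, by simp, fun p => ?_⟩
  rw [run_append, hs]

/-- Cores of transducers with a common state (up to `ω`-equivalence) have the same states. -/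
theorem range_act_core_subset {A B : Transducer n} (hB : B.StronglySync)
    {a : A.Q} {b : B.Q} (h : A.act a = B.act b) :
    Set.range A.core.act ⊆ Set.range B.core.act := by
  rintro _ ⟨⟨q, hq⟩, rfl⟩
  obtain ⟨l, hl⟩ := hB
  obtain ⟨w, hw, hwq⟩ := exists_word_of_mem_coreSet hq l
  refine ⟨⟨B.run w b, run_mem_coreSet w (hl.mono hw) b⟩, ?_⟩
  rw [act_core, act_core, ← act_run_congr w h, hwq]

theorem range_act_core {A B : Transducer n} (hA : A.StronglySync) (hB : B.StronglySync)
    {a : A.Q} {b : B.Q} (h : A.act a = B.act b) :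
    Set.range A.core.act = Set.range B.core.act :=
  (range_act_core_subset hB h).antisymm (range_act_core_subset hA h.symm)

theorem StronglySync.prod {T U : Transducer n} (hT : T.StronglySync) (hU : U.StronglySync) :
    (T.prod U).StronglySync := by
  have := hT.nonempty
  have := hU.nonempty
  have : Nonempty (T.prod U).Q := inferInstanceAs (Nonempty (T.Q × U.Q))
  obtain ⟨j, hj⟩ := hT
  obtain ⟨k, hk⟩ := hU
  refine ⟨j + k, syncAt_of_forall ?_⟩
  rintro w hw ⟨p, q⟩ ⟨p', q'⟩
  have hl : ((w.drop j).length) = k := by simp; omega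
  rw [← List.take_append_drop j w, run_append, run_append, run_prod T U _ p q,
    run_prod T U _ p' q', hj.run_eq (w.take j) (by simp; omega) p p', run_prod, run_prod]
  exact congrArg (Prod.mk _) (hk.run_eq _ ((length_outWord _ _ _).trans hl) _ _)

end Transducer

/-! ### The monoid of core, strongly synchronizing, synchronous transducers -/

/-- The weakly minimal, core (hence strongly synchronizing), synchronous transducers. -/
abbrev CoreTransducer (n : ℕ) : Type 1 :=
  {T : Transducer n // T.IsCore ∧ T.WeaklyMinimal}

/-- `ω`-equality as an equivalence relation. -/
instance CoreTransducer.setoid (n : ℕ) : Setoid (CoreTransducer n) where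
  r T U := T.1.OmegaEqual U.1
  iseqv :=
    { refl := fun _ => ⟨Equiv.refl _, fun _ => rfl⟩
      symm := fun ⟨f, hf⟩ => ⟨f.symm, fun q => by rw [hf, Equiv.apply_symm_apply]⟩
      trans := fun ⟨f, hf⟩ ⟨g, hg⟩ => ⟨f.trans g, fun q => by rw [hf, hg]; rfl⟩ }

/-- The set of weakly minimal, core, strongly synchronizing, synchronous transducers, up to
`ω`-equality. -/
def SyncMonoid (n : ℕ) : Type 1 := Quotient (CoreTransducer.setoid n)

/-- The class of a weakly minimal core transducer. -/
def SyncMonoid.mk {n : ℕ} (T : CoreTransducer n) : SyncMonoid n := Quotient.mk _ T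

namespace Transducer

variable {n : ℕ}

/-- The weakly minimal representative of the core of a strongly synchronizing transducer. -/
abbrev reduce (T : Transducer n) (h : T.StronglySync) : CoreTransducer n :=
  ⟨T.core.wmin, h.isCore_core.wmin, T.core.wmin_weaklyMinimal⟩

/-- The class of the weakly minimal representative of the core. -/
def toClass (T : Transducer n) (h : T.StronglySync) : SyncMonoid n :=
  SyncMonoid.mk (T.reduce h)

theorem range_act_reduce (T : Transducer n) (h : T.StronglySync) :
    Set.range (T.reduce h).1.act = Set.range T.core.act :=
  T.core.range_act_wmin

theorem toClass_eq [n.AtLeastTwo] {A B : Transducer n} (hA : A.StronglySync) (hB : B.StronglySync)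
    {a : A.Q} {b : B.Q} (h : A.act a = B.act b) : A.toClass hA = B.toClass hB := by
  apply Quotient.sound
  apply omegaEqual_of_range_eq (A.reduce hA).2.2 (B.reduce hB).2.2
  rw [range_act_reduce, range_act_reduce, range_act_core hA hB h]

theorem toClass_self (T : CoreTransducer n) : T.1.toClass T.2.1.1 = SyncMonoid.mk T := by
  apply Quotient.sound
  apply omegaEqual_of_range_eq (T.1.reduce T.2.1.1).2.2 T.2.2
  rw [range_act_reduce]
  ext g
  constructor
  · rintro ⟨q, rfl⟩
    exact ⟨q.1, (act_core _ q).symm⟩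
  · rintro ⟨q, rfl⟩
    exact ⟨⟨q, T.2.1.2.ge (Set.mem_univ q)⟩, act_core _ _⟩

theorem exists_reduce_act [n.AtLeastTwo] (T : Transducer n) (h : T.StronglySync) :
    ∃ (a : (T.reduce h).1.Q) (b : T.Q), (T.reduce h).1.act a = T.act b := by
  obtain ⟨a⟩ := (T.reduce h).2.1.1.nonempty
  obtain ⟨b, hb⟩ := (range_act_reduce T h).le ⟨a, rfl⟩
  exact ⟨a, b.1, by rw [← hb, act_core]⟩

end Transducer

namespace SyncMonoid

open Transducer

variable {n : ℕ} [n.AtLeastTwo]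

/-- The product of classes: form the product of transducers, remove the states outside the core,
and identify `ω`-equivalent states. -/
def mul : SyncMonoid n → SyncMonoid n → SyncMonoid n :=
  Quotient.lift₂ (fun T U => (T.1.prod U.1).toClass (T.2.1.1.prod U.2.1.1)) (by
    rintro T U T' U' ⟨f, hf⟩ ⟨g, hg⟩
    obtain ⟨p⟩ := T.2.1.1.nonempty
    obtain ⟨q⟩ := U.2.1.1.nonempty
    apply toClass_eq (a := (p, q)) (b := (f p, g q))
    rw [act_prod, act_prod, hf, hg])

theorem mul_toClass {A B : Transducer n} (hA : A.StronglySync) (hB : B.StronglySync) :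
    mul (A.toClass hA) (B.toClass hB) = (A.prod B).toClass (hA.prod hB) := by
  obtain ⟨a, a', ha⟩ := A.exists_reduce_act hA
  obtain ⟨b, b', hb⟩ := B.exists_reduce_act hB
  apply toClass_eq (a := (a, b)) (b := (a', b'))
  rw [act_prod, act_prod, ha, hb]

theorem exists_toClass {n : ℕ} (P : SyncMonoid n) : ∃ (A : Transducer n) (h : A.StronglySync),
    P = A.toClass h := by
  induction P using Quotient.inductionOn with | _ T =>
  exact ⟨T.1, T.2.1.1, (toClass_self T).symm⟩

instance instMonoid : Monoid (SyncMonoid n) where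
  mul := mul
  one := mk ⟨one n, one_isCore n, one_weaklyMinimal n⟩
  mul_assoc P₁ P₂ P₃ := by
    obtain ⟨A, hA, rfl⟩ := exists_toClass P₁
    obtain ⟨B, hB, rfl⟩ := exists_toClass P₂
    obtain ⟨C, hC, rfl⟩ := exists_toClass P₃
    change mul (mul _ _) _ = mul _ (mul _ _)
    rw [mul_toClass, mul_toClass, mul_toClass, mul_toClass]
    obtain ⟨a⟩ := hA.nonempty
    obtain ⟨b⟩ := hB.nonempty
    obtain ⟨c⟩ := hC.nonempty
    apply toClass_eq (a := ((a, b), c)) (b := (a, (b, c)))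
    rw [act_prod, act_prod, act_prod, act_prod]
    rfl
  one_mul P := by
    obtain ⟨A, hA, rfl⟩ := exists_toClass P
    change mul (mk _) _ = _
    rw [← toClass_self, mul_toClass]
    obtain ⟨a⟩ := hA.nonempty
    exact toClass_eq (a := ((), a)) (b := a) _ _ (act_prod _ _ _ _)
  mul_one P := by
    obtain ⟨A, hA, rfl⟩ := exists_toClass P
    change mul _ (mk _) = _
    rw [← toClass_self, mul_toClass]
    obtain ⟨a⟩ := hA.nonempty
    exact toClass_eq (a := (a, ())) (b := a) _ _ (act_prod _ _ _ _)

theorem mk_mul_mk (T U : CoreTransducer n) :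
    mk T * mk U = mk ((T.1.prod U.1).reduce (T.2.1.1.prod U.2.1.1)) := rfl

end SyncMonoid

/-- The monoid `SH_n` of (classes of) weakly minimal, core, strongly synchronizing, synchronous
transducers all of whose states are homeomorphism states. -/
def SH (n : ℕ) [n.AtLeastTwo] : Submonoid (SyncMonoid n) where
  carrier := {P | ∃ T : CoreTransducer n,
    SyncMonoid.mk T = P ∧ ∀ q, IsHomeomorph (T.1.act q)}
  one_mem' := ⟨_, rfl, fun _ => IsHomeomorph.id⟩
  mul_mem' := by
    rintro _ _ ⟨T, rfl, hT⟩ ⟨U, rfl, hU⟩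
    refine ⟨_, (SyncMonoid.mk_mul_mk T U).symm, fun q => ?_⟩
    obtain ⟨⟨⟨p, q⟩, _⟩, hb⟩ := (Transducer.range_act_reduce _ _).le ⟨q, rfl⟩
    rw [← hb, Transducer.act_core, Transducer.act_prod]
    exact (hU q).comp (hT p)

namespace Transducer

variable {n : ℕ}

theorem out_perm_symm (T : Transducer n) (h : T.Invertible) (q : T.Q) (x : Fin n) :
    T.out ((T.perm h q).symm x) q = x :=
  (T.perm h q).apply_symm_apply x

theorem perm_symm_out (T : Transducer n) (h : T.Invertible) (q : T.Q) (x : Fin n) :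
    (T.perm h q).symm (T.out x q) = x :=
  (T.perm h q).symm_apply_apply x

theorem inv_invertible (T : Transducer n) (h : T.Invertible) : (T.inv h).Invertible :=
  fun q => (T.perm h q).symm.bijective

theorem stateAt_inv (T : Transducer n) (h : T.Invertible) (q : T.Q) (x : ℕ → Fin n) (i : ℕ) :
    (T.inv h).stateAt q (T.act q x) i = T.stateAt q x i := by
  induction i with
  | zero => rfl
  | succ i ih =>
    rw [stateAt, ih]
    change T.trans ((T.perm h _).symm (T.out _ _)) _ = _
    rw [perm_symm_out]
    rfl

theorem act_inv_act (T : Transducer n) (h : T.Invertible) (q : T.Q) (x : ℕ → Fin n) :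
    (T.inv h).act q (T.act q x) = x := by
  funext i
  change (T.inv h).out _ _ = _
  rw [stateAt_inv]
  exact T.perm_symm_out h _ _

theorem stateAt_inv' (T : Transducer n) (h : T.Invertible) (q : T.Q) (x : ℕ → Fin n) (i : ℕ) :
    T.stateAt q ((T.inv h).act q x) i = (T.inv h).stateAt q x i := by
  induction i with
  | zero => rfl
  | succ i ih =>
    rw [stateAt, ih]
    rfl

theorem act_act_inv (T : Transducer n) (h : T.Invertible) (q : T.Q) (x : ℕ → Fin n) :
    T.act q ((T.inv h).act q x) = x := by
  funext i
  change T.out _ (T.stateAt q _ i) = _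
  rw [stateAt_inv']
  exact T.out_perm_symm h _ _

theorem run_inv (T : Transducer n) (h : T.Invertible) (w : List (Fin n)) :
    ∀ q : T.Q, (T.inv h).run (T.outWord w q) q = T.run w q := by
  induction w with
  | nil => intro q; rfl
  | cons x w ih =>
    intro q
    change (T.inv h).run _ (T.trans ((T.perm h q).symm (T.out x q)) q) = _
    rw [perm_symm_out]
    exact ih _

theorem run_mem_coreSet' {T : Transducer n} (w : List (Fin n)) :
    ∀ {q : T.Q}, q ∈ T.coreSet → T.run w q ∈ T.coreSet := by
  induction w with
  | nil => intro q h; exact h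
  | cons x w ih => intro q h; exact ih (trans_mem_coreSet x h)

theorem inv_isCore [n.AtLeastTwo] {T : Transducer n} (hT : T.IsCore) (h : T.Invertible)
    (hi : (T.inv h).StronglySync) : (T.inv h).IsCore := by
  refine ⟨hi, Set.eq_univ_of_forall fun q => ?_⟩
  obtain ⟨k, s, hs⟩ := hi
  have hc : s (List.Vector.replicate k 0) ∈ (T.inv h).coreSet := ⟨k, s, hs, _, rfl⟩
  obtain ⟨w, -, hw⟩ := exists_word_of_mem_coreSet (T := T) (hT.2.ge (Set.mem_univ q)) 0
  have h1 := run_mem_coreSet' (T.outWord w (s (List.Vector.replicate k 0))) hc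
  have h2 := T.run_inv h w (s (List.Vector.replicate k 0))
  rw [hw] at h2
  rwa [h2] at h1

theorem inv_weaklyMinimal {T : Transducer n} (hT : T.WeaklyMinimal) (h : T.Invertible) :
    (T.inv h).WeaklyMinimal := by
  intro p q hpq
  apply hT p q
  funext x
  have h1 := T.act_act_inv h q (T.act p x)
  rw [← hpq, act_inv_act] at h1
  exact h1.symm

theorem inv_inv_stronglySync {T : Transducer n} (hT : T.StronglySync) (h : T.Invertible)
    (h' : (T.inv h).Invertible) : ((T.inv h).inv h').StronglySync := by
  refine stronglySync_of_surjective (T := T) (U := (T.inv h).inv h') (fun q => q) ?_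
    Function.surjective_id hT
  intro x q
  change T.trans x q = T.trans ((T.perm h q).symm (((T.inv h).perm h' q).symm x)) q
  congr 1
  exact (((T.inv h).perm h' q).apply_symm_apply x).symm

/-- `T` is bi-synchronizing: it is invertible, and `T` and `T⁻¹` are strongly synchronizing. -/
def BiSync (T : Transducer n) : Prop :=
  T.StronglySync ∧ ∃ h : T.Invertible, (T.inv h).StronglySync

theorem continuous_act (T : Transducer n) (q : T.Q) : Continuous (T.act q) := by
  have key : ∀ (i : ℕ) (x y : ℕ → Fin n), (∀ j < i, x j = y j) →
      T.stateAt q x i = T.stateAt q y i := by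
    intro i
    induction i with
    | zero => intros; rfl
    | succ i ih =>
      intro x y h
      rw [stateAt, stateAt, h i (by omega), ih x y (fun j hj => h j (by omega))]
  refine continuous_pi fun i => ?_
  have : (fun x => T.act q x i) =
      (fun z : Fin (i + 1) → Fin n =>
        T.act q (fun j => if hj : j < i + 1 then z ⟨j, hj⟩ else z 0) i) ∘
      (fun x j => x j) := by
    funext x
    simp only [Function.comp, act]
    congr 1
    · simp
    · apply key
      intro j hj
      simp [show j < i + 1 by omega]
  rw [this]
  exact continuous_of_discreteTopology.comp (by fun_prop)

theorem Invertible.isHomeomorph {T : Transducer n} (h : T.Invertible) (q : T.Q) :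
    IsHomeomorph (T.act q) :=
  isHomeomorph_iff_continuous_bijective.2 ⟨T.continuous_act q,
    Function.bijective_iff_has_inverse.2 ⟨(T.inv h).act q, T.act_inv_act h q, T.act_act_inv h q⟩⟩

theorem BiSync.prod [n.AtLeastTwo] {T U : Transducer n} (hT : T.BiSync) (hU : U.BiSync) :
    (T.prod U).BiSync := by
  obtain ⟨hT, iT, sT⟩ := hT
  obtain ⟨hU, iU, sU⟩ := hU
  have hi : (T.prod U).Invertible := fun q => (iU q.2).comp (iT q.1)
  refine ⟨hT.prod hU, hi, ?_⟩
  refine stronglySync_of_surjective (T := (U.inv iU).prod (T.inv iT)) (U := (T.prod U).inv hi)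
    (fun q => (q.2, q.1)) ?_ Prod.swap_surjective (sU.prod sT)
  rintro x ⟨q, p⟩
  have h1 : ((T.prod U).perm hi (p, q)).symm x = (T.perm iT p).symm ((U.perm iU q).symm x) := by
    rw [Equiv.symm_apply_eq]
    change x = U.out (T.out _ p) q
    rw [out_perm_symm, out_perm_symm]
  change _ = ((T.trans (((T.prod U).perm hi (p, q)).symm x) p,
    U.trans (T.out (((T.prod U).perm hi (p, q)).symm x) p) q) : T.Q × U.Q)
  rw [h1, out_perm_symm]

theorem BiSync.reduce [n.AtLeastTwo] {T : Transducer n} (hT : T.BiSync) :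
    (T.reduce hT.1).1.BiSync := by
  obtain ⟨hT, iT, sT⟩ := hT
  have ic : T.core.Invertible := fun q => iT q.1
  have im : T.core.wmin.Invertible := by
    intro q
    induction q using Quotient.inductionOn with | _ q =>
    exact ic q
  have : Nonempty (T.core.inv ic).Q := hT.isCore_core.1.nonempty
  have sc : (T.core.inv ic).StronglySync :=
    stronglySync_of_injective (U := T.inv iT) Subtype.val (fun _ _ => rfl)
      Subtype.val_injective sT
  exact ⟨(T.reduce hT).2.1.1, im, stronglySync_of_surjective (T := T.core.inv ic)
    (U := T.core.wmin.inv im) (Quotient.mk T.core.stateSetoid) (fun _ _ => rfl)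
    Quotient.mk_surjective sc⟩

end Transducer

/-- The inverse of a bi-synchronizing transducer is again weakly minimal and core. -/
noncomputable abbrev CoreTransducer.inv {n : ℕ} [n.AtLeastTwo] (T : CoreTransducer n)
    (h : T.1.BiSync) : CoreTransducer n :=
  ⟨T.1.inv h.2.choose, Transducer.inv_isCore T.2.1 _ h.2.choose_spec,
    Transducer.inv_weaklyMinimal T.2.2 _⟩

/-- The group `H_n` of (classes of) weakly minimal, core, synchronous, bi-synchronizing
transducers. -/
def HGroup (n : ℕ) [n.AtLeastTwo] : Submonoid (SyncMonoid n) where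
  carrier := {P | ∃ T : CoreTransducer n, SyncMonoid.mk T = P ∧ T.1.BiSync}
  one_mem' := by
    refine ⟨_, rfl, (Transducer.one_isCore n).1, fun _ => Function.bijective_id, 0, ?_⟩
    exact ⟨fun _ => (), fun _ _ => rfl⟩
  mul_mem' := by
    rintro _ _ ⟨T, rfl, hT⟩ ⟨U, rfl, hU⟩
    exact ⟨_, (SyncMonoid.mk_mul_mk T U).symm, (hT.prod hU).reduce⟩

theorem HGroup_le_SH (n : ℕ) [n.AtLeastTwo] : HGroup n ≤ SH n := by
  rintro _ ⟨T, rfl, -, h, -⟩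
  exact ⟨T, rfl, h.isHomeomorph⟩

theorem CoreTransducer.inv_biSync {n : ℕ} [n.AtLeastTwo] (T : CoreTransducer n) (h : T.1.BiSync) :
    (T.inv h).1.BiSync :=
  ⟨(T.inv h).2.1.1, Transducer.inv_invertible _ _, Transducer.inv_inv_stronglySync h.1 _ _⟩

theorem CoreTransducer.mul_inv {n : ℕ} [n.AtLeastTwo] (T : CoreTransducer n) (h : T.1.BiSync) :
    SyncMonoid.mk T * SyncMonoid.mk (T.inv h) = 1 := by
  obtain ⟨q⟩ := h.1.nonempty
  refine (Transducer.toClass_eq (a := (q, q)) (b := ()) _ (Transducer.one_isCore n).1 ?_).trans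
    (Transducer.toClass_self ⟨_, Transducer.one_isCore n, Transducer.one_weaklyMinimal n⟩)
  rw [Transducer.act_prod]
  funext x
  exact T.1.act_inv_act _ q x

theorem CoreTransducer.inv_mul {n : ℕ} [n.AtLeastTwo] (T : CoreTransducer n) (h : T.1.BiSync) :
    SyncMonoid.mk (T.inv h) * SyncMonoid.mk T = 1 := by
  obtain ⟨q⟩ := h.1.nonempty
  refine (Transducer.toClass_eq (a := (q, q)) (b := ()) _ (Transducer.one_isCore n).1 ?_).trans
    (Transducer.toClass_self ⟨_, Transducer.one_isCore n, Transducer.one_weaklyMinimal n⟩)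
  rw [Transducer.act_prod]
  funext x
  exact T.1.act_act_inv _ q x

/-- `H_n` is a group; inverses are given by the inverse transducers. -/
noncomputable instance HGroup.instGroup (n : ℕ) [n.AtLeastTwo] : Group (HGroup n) :=
  groupOfIsUnit (by
    rintro ⟨_, T, rfl, h⟩
    exact ⟨⟨⟨_, T, rfl, h⟩, ⟨_, T.inv h, rfl, T.inv_biSync h⟩,
      Subtype.ext (T.mul_inv h), Subtype.ext (T.inv_mul h)⟩, rfl⟩)

/-! ### Sliding block maps and the shift -/

/-- The sliding block map `f_∞` of `X_n^ℤ` given by `f : X_n^m → X_n`: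
`y_i = f (x_{i-m+1} … x_i)`. -/
def slide {n m : ℕ} (f : (Fin m → Fin n) → Fin n) (x : ℤ → Fin n) : ℤ → Fin n :=
  fun i => f (fun j => x (i - m + 1 + j))

/-- `f : X_n^{k+1} → X_n` is right permutive: for every block `a` of length `k` the map
`x ↦ f (a x)` is a permutation of the alphabet. -/
def RightPermutive {n k : ℕ} (f : (Fin (k + 1) → Fin n) → Fin n) : Prop :=
  ∀ a : Fin k → Fin n, Function.Bijective (fun x : Fin n => f (Fin.snoc a x))

/-- The block map on windows of length `k + l + 1` of the composite: first `f`, then `g`. -/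
def blockComp {n k l : ℕ} (f : (Fin (k + 1) → Fin n) → Fin n) (g : (Fin (l + 1) → Fin n) → Fin n) :
    (Fin (k + l + 1) → Fin n) → Fin n :=
  fun z => g (fun j => f (fun i => z ⟨j + i, by omega⟩))

theorem slide_blockComp {n k l : ℕ} (f : (Fin (k + 1) → Fin n) → Fin n)
    (g : (Fin (l + 1) → Fin n) → Fin n) (x : ℤ → Fin n) :
    slide (blockComp f g) x = slide g (slide f x) := by
  funext i
  simp only [slide, blockComp]
  congr 1
  funext j
  congr 1
  funext t
  congr 1
  push_cast
  ring

theorem RightPermutive.blockComp {n k l : ℕ} {f : (Fin (k + 1) → Fin n) → Fin n}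
    {g : (Fin (l + 1) → Fin n) → Fin n} (hf : RightPermutive f) (hg : RightPermutive g) :
    RightPermutive (blockComp f g) := by
  intro a
  have h : (fun x => _root_.blockComp f g (Fin.snoc a x)) =
      (fun y => g (Fin.snoc (fun j : Fin l => f (fun i : Fin (k + 1) => a ⟨j + i, by omega⟩)) y)) ∘
        (fun x => f (Fin.snoc (fun i : Fin k => a ⟨l + i, by omega⟩) x)) := by
    funext x
    simp only [_root_.blockComp, Function.comp]
    congr 1
    funext j
    refine Fin.lastCases ?_ (fun j => ?_) j
    · rw [Fin.snoc_last]
      congr 1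
      funext i
      refine Fin.lastCases ?_ (fun i => ?_) i
      · rw [Fin.snoc_last]
        have : (⟨((Fin.last l : Fin (l + 1)) : ℕ) + (Fin.last k : Fin (k + 1)), by simp; omega⟩ :
          Fin (k + l + 1)) = Fin.last (k + l) := Fin.ext (by simp; omega)
        rw [this, Fin.snoc_last]
      · rw [Fin.snoc_castSucc]
        have : (⟨((Fin.last l : Fin (l + 1)) : ℕ) + i.castSucc, by simp; omega⟩ :
          Fin (k + l + 1)) = Fin.castSucc ⟨l + i, by omega⟩ := Fin.ext (by simp)
        rw [this, Fin.snoc_castSucc]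
    · rw [Fin.snoc_castSucc]
      congr 1
      funext i
      have : (⟨(j.castSucc : ℕ) + i, by simp; omega⟩ :
        Fin (k + l + 1)) = Fin.castSucc ⟨j + i, by omega⟩ := Fin.ext (by simp)
      rw [this, Fin.snoc_castSucc]
  rw [h]
  exact (hg _).comp (hf _)

/-- The monoid `RF_∞(X_n)` of the maps `f_∞ : X_n^ℤ → X_n^ℤ`, `f` right permutive. Maps act on the
right: the product of `f_∞` and `g_∞` is the map "first `f_∞`, then `g_∞`", which is the product of
the opposite of the monoid `Function.End`. -/
def RF (n : ℕ) : Submonoid (Function.End (ℤ → Fin n))ᵐᵒᵖ where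
  carrier := {F | ∃ (k : ℕ) (f : (Fin (k + 1) → Fin n) → Fin n),
    RightPermutive f ∧ F = MulOpposite.op (slide f)}
  one_mem' := by
    refine ⟨0, fun z => z 0, fun a => ?_, ?_⟩
    · have : (fun x : Fin n => (Fin.snoc a x : Fin 1 → Fin n) 0) = id := by
        funext x
        exact Fin.snoc_last (α := fun _ => Fin n) x a
      rw [this]
      exact Function.bijective_id
    · apply MulOpposite.unop_injective
      funext x i
      change x i = x (i - ((0 + 1 : ℕ) : ℤ) + 1 + ((0 : Fin 1) : ℕ))
      simp
  mul_mem' := by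
    rintro _ _ ⟨k, f, hf, rfl⟩ ⟨l, g, hg, rfl⟩
    refine ⟨k + l, blockComp f g, hf.blockComp hg, ?_⟩
    apply MulOpposite.unop_injective
    funext x
    exact (slide_blockComp f g x).symm

/-- The shift map of `X_n^{-ℕ}`. A point `… x_{-2} x_{-1} x_0` is represented by the map
`k ↦ x_{-k}`, so `y_i = x_{i-1}` for `i ≤ 0` reads `y k = x (k + 1)`. -/
def shift (n : ℕ) (x : ℕ → Fin n) : ℕ → Fin n :=
  fun k => x (k + 1)

/-- The group `Aut(X_n^{-ℕ}, σ_n)` of the homeomorphisms of the one-sided full shift that commute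
with the shift map. -/
def ShiftAut (n : ℕ) : Subgroup ((ℕ → Fin n) ≃ₜ (ℕ → Fin n)) where
  carrier := {h | ∀ x, h (shift n x) = shift n (h x)}
  one_mem' := fun _ => rfl
  mul_mem' := by
    intro g h hg hh x
    change g (h _) = shift n (g (h x))
    rw [hh, hg]
  inv_mem' := by
    intro h hh x
    change h.symm _ = shift n (h.symm x)
    rw [Homeomorph.symm_apply_eq, hh, Homeomorph.apply_symm_apply]

/-! ### The Higman–Thompson groups and outer automorphisms -/

/-- The Cantor space `C_{n,r}`: `r` disjoint copies of `X_n^ℕ`. -/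
abbrev CantorSpace (n r : ℕ) : Type := Fin r × Stream' (Fin n)

/-- `h` is given by a finite table of prefix replacements: for some `m`, each of the finitely many
cones of depth `m` is mapped to a cone by replacing the prefix. (Every finite partition
of `C_{n,r}` into cones is refined by the partition into the cones of some depth `m`.) -/
def IsPrefixReplacement {n r : ℕ} (h : Equiv.Perm (CantorSpace n r)) : Prop :=
  ∃ m : ℕ, ∀ (i : Fin r) (u : List (Fin n)), u.length = m →
    ∃ (j : Fin r) (v : List (Fin n)), ∀ w : Stream' (Fin n), h (i, u ++ₛ w) = (j, v ++ₛ w)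

theorem IsPrefixReplacement.mul {n r : ℕ} {g h : Equiv.Perm (CantorSpace n r)}
    (hg : IsPrefixReplacement g) (hh : IsPrefixReplacement h) : IsPrefixReplacement (g * h) := by
  obtain ⟨a, hg⟩ := hg
  obtain ⟨b, hh⟩ := hh
  refine ⟨b + a, fun i u hu => ?_⟩
  obtain ⟨j, v, hv⟩ := hh i (u.take b) (by simp; omega)
  obtain ⟨k, t, ht⟩ := hg j ((v ++ u.drop b).take a) (by simp; omega)
  refine ⟨k, t ++ (v ++ u.drop b).drop a, fun w => ?_⟩
  rw [Stream'.append_append_stream, ← ht, ← Stream'.append_append_stream, List.take_append_drop,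
    Stream'.append_append_stream, ← hv, ← Stream'.append_append_stream, List.take_append_drop]
  rfl

theorem IsPrefixReplacement.inv {n r : ℕ} {h : Equiv.Perm (CantorSpace n r)}
    (hh : IsPrefixReplacement h) : IsPrefixReplacement h⁻¹ := by
  obtain ⟨m, hm⟩ := hh
  choose j v hv using hm
  have : Finite {u : List (Fin n) // u.length = m} := List.finite_length_eq (Fin n) m
  obtain ⟨M, hM⟩ := (Set.finite_range
    (fun p : Fin r × {u : List (Fin n) // u.length = m} => (v p.1 p.2.1 p.2.2).length)).bddAbove
  refine ⟨M, fun k t ht => ?_⟩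
  by_cases hn : Nonempty (Fin n)
  · obtain ⟨x⟩ := hn
    obtain ⟨⟨i, z⟩, hz⟩ := h.surjective (k, t ++ₛ Stream'.const x)
    have hl : (z.take m).length = m := by simp
    have h1 := hv i (z.take m) hl (z.drop m)
    rw [Stream'.append_take_drop, hz] at h1
    have hle : (v i (z.take m) hl).length ≤ t.length := by
      rw [ht]
      exact hM ⟨(i, ⟨z.take m, hl⟩), rfl⟩
    have hk : k = j i (z.take m) hl := congrArg Prod.fst h1
    have h2 := congrArg (fun s => Stream'.take (v i (z.take m) hl).length s.2) h1
    simp only at h2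
    rw [Stream'.take_append_of_le_length _ _ _ hle, Stream'.take_append_of_le_length _ _ _ le_rfl,
      List.take_length] at h2
    refine ⟨i, z.take m ++ t.drop (v i (z.take m) hl).length, fun w => ?_⟩
    have h3 : v i (z.take m) hl ++ t.drop (v i (z.take m) hl).length = t := by
      conv_lhs => rw [← congrArg (· ++ t.drop (v i (z.take m) hl).length) h2]
      exact List.take_append_drop _ _
    rw [Equiv.Perm.inv_eq_iff_eq, Stream'.append_append_stream, hv i _ hl, ← hk,
      ← Stream'.append_append_stream, h3]
  · exact ⟨k, t, fun w => (hn ⟨w 0⟩).elim⟩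

/-- The Higman–Thompson group `G_{n,r}`, as the group of the bijections (hence homeomorphisms) of
`C_{n,r}` that are given by a finite table of prefix replacements. -/
def HigmanThompson (n r : ℕ) : Subgroup (Equiv.Perm (CantorSpace n r)) where
  carrier := {h | IsPrefixReplacement h}
  one_mem' := ⟨0, fun i u _ => ⟨i, u, fun _ => rfl⟩⟩
  mul_mem' := IsPrefixReplacement.mul
  inv_mem' := IsPrefixReplacement.inv

/-- The subgroup of inner automorphisms is normal. -/
instance Inn.normal (G : Type*) [Group G] : (MulAut.conj : G →* MulAut G).range.Normal := by
  constructor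
  rintro _ ⟨g, rfl⟩ φ
  refine ⟨φ g, ?_⟩
  ext x
  simp [MulAut.conj_apply]

/-- The outer automorphism group `Out(G) = Aut(G) / Inn(G)`. -/
abbrev Out (G : Type*) [Group G] : Type _ :=
  MulAut G ⧸ (MulAut.conj : G →* MulAut G).range

/-! A strongly synchronizing transducer forgets its initial state, so a left-infinite past
determines a state (`pastState`). Reading every letter in the state determined by its own past gives
a continuous, shift-commuting map of the left-infinite sequences (`leftAct`), that is, a sliding
block map. This action turns products into composites (`leftAct_prod`). It is faithful on classes:
it recovers the maps induced by the states that pasts lead to, and two strongly synchronizing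
transducers with one pair of equivalent states have the same reduced core (`toClass_eq`).
Conversely, each block map is the action of a de Bruijn transducer, which keeps the last letters as
its state.

Under this dictionary, right permutivity of the block map corresponds to every state permuting the
letters, which all homeomorphism states do. Passing from pasts to bi-infinite sequences (`biLift`)
gives (1). For (2), compactness makes a shift-commuting homeomorphism a block map, and injectivity
makes it right permutive (`exists_leftAct_eq`). The inverse transducer synchronizes because a
transducer for the inverse homeomorphism recovers the past, hence the state, from the output
(`inv_stronglySync_of_leftInverse`).

For (3), a state of a bi-synchronizing transducer permutes the Cantor space copy by copy.
Synchronization makes this permutation normalize $G_{n,r}$ (`conj_cantorPerm_mem`), and two states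
differ by an element of $G_{n,r}$ (`inv_cantorPerm_mul_mem`), so one outer automorphism is attached
to the transducer. Since $G_{n,r}$ has trivial centralizer (`eq_one_of_commute_higmanThompson`), the
outer automorphism is trivial only if the permutation lies in $G_{n,r}$; then some state acts as the
identity (`exists_act_eq_id`) and the class is trivial. -/

/-! ### The action of strongly synchronizing transducers on left-infinite sequences -/

/-- The left-infinite sequence `p u`; as for `shift`, `p k` is the letter at position `-k`. -/
def extendPast {n : ℕ} (p : ℕ → Fin n) : List (Fin n) → ℕ → Fin n
  | [] => p
  | x :: u => extendPast (Transducer.consSeq x p) u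

/-- The last `l` letters of the left-infinite sequence `p`. -/
def recent {n : ℕ} (p : ℕ → Fin n) : ℕ → List (Fin n)
  | 0 => []
  | l + 1 => recent (shift n p) l ++ [p 0]

/-! ### Finite words at the end of a left-infinite sequence. -/

section Words

variable {n : ℕ}

theorem length_recent (l : ℕ) : ∀ p : ℕ → Fin n, (recent p l).length = l := by
  induction l with
  | zero => intro p; rfl
  | succ l ih => intro p; simp [recent, ih]

theorem recent_succ_eq_cons (l : ℕ) : ∀ p : ℕ → Fin n, recent p (l + 1) = p l :: recent p l := by
  induction l with
  | zero => intro p; rfl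
  | succ l ih => intro p; rw [recent, ih, recent]; rfl

theorem recent_eq_ofFn (l : ℕ) : ∀ p : ℕ → Fin n,
    recent p l = List.ofFn (fun j : Fin l => p (l - 1 - j)) := by
  induction l with
  | zero => intro p; rfl
  | succ l ih =>
    intro p
    rw [recent_succ_eq_cons, ih, List.ofFn_succ]
    congr 2
    funext j
    congr 1
    simp only [Fin.val_succ]
    omega

theorem recent_extendPast (u : List (Fin n)) : ∀ (p : ℕ → Fin n) (l : ℕ),
    recent (extendPast p u) (u.length + l) = recent p l ++ u := by
  induction u with
  | nil => intro p l; simp [extendPast]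
  | cons x u ih =>
    intro p l
    rw [extendPast, List.length_cons, Nat.add_assoc, Nat.add_comm 1, ih, recent]
    rw [List.append_assoc]
    rfl

theorem recent_extendPast_length (p : ℕ → Fin n) (u : List (Fin n)) :
    recent (extendPast p u) u.length = u := by
  simpa [recent] using recent_extendPast u p 0

end Words

/-! ### States and outputs determined by a left-infinite past. -/

namespace Transducer

variable {n : ℕ}

theorem outWord_append (T : Transducer n) (v w : List (Fin n)) :
    ∀ q, T.outWord (v ++ w) q = T.outWord v q ++ T.outWord w (T.run v q) := by
  induction v with
  | nil => intro q; rfl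
  | cons x v ih => intro q; simp [outWord, run, ih]

/-- Reading older letters first only changes the state in which the last `k` letters are read, and
those letters erase that difference. -/
theorem SyncAt.run_recent {T : Transducer n} {k l : ℕ} (h : T.SyncAt k) (hl : k ≤ l)
    (p : ℕ → Fin n) (a b : T.Q) : T.run (recent p l) a = T.run (recent p k) b := by
  induction l, hl using Nat.le_induction generalizing a with
  | base => exact h.run_eq _ (length_recent _ _) _ _
  | succ l _ ih => rw [recent_succ_eq_cons]; exact ih _

variable [n.AtLeastTwo]

/-- The state of a strongly synchronizing transducer after reading the left-infinite
sequence `p`. -/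
noncomputable def pastState (T : Transducer n) (h : T.StronglySync) (p : ℕ → Fin n) : T.Q :=
  T.run (recent p h.choose) h.nonempty.some

theorem pastState_eq {T : Transducer n} (h : T.StronglySync) {k : ℕ} (hk : T.SyncAt k)
    (p : ℕ → Fin n) (q : T.Q) : T.pastState h p = T.run (recent p k) q :=
  (h.choose_spec.run_recent (le_max_left _ k) p q _).symm.trans
    (hk.run_recent (le_max_right _ _) p q _)

theorem pastState_eq_trans (T : Transducer n) (h : T.StronglySync) (p : ℕ → Fin n) :
    T.pastState h p = T.trans (p 0) (T.pastState h (shift n p)) := by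
  obtain ⟨k, hk⟩ := id h
  obtain ⟨q⟩ := h.nonempty
  -- Level `k + 1` for `p` and level `k` for its shift: the longer word is the shorter one followed
  -- by `p 0`.
  rw [pastState_eq h (hk.mono k.le_succ) p q, pastState_eq h hk _ q, recent, run_append]
  rfl

theorem run_recent_pastState (T : Transducer n) (h : T.StronglySync) (l : ℕ) :
    ∀ p : ℕ → Fin n, T.run (recent p l) (T.pastState h ((shift n)^[l] p)) = T.pastState h p := by
  induction l with
  | zero => intro p; rfl
  | succ l ih =>
    intro p
    rw [recent, run_append, Function.iterate_succ_apply, ih, T.pastState_eq_trans h p]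
    rfl

theorem pastState_extendPast (T : Transducer n) (h : T.StronglySync) (u : List (Fin n)) :
    ∀ p : ℕ → Fin n, T.pastState h (extendPast p u) = T.run u (T.pastState h p) := by
  induction u with
  | nil => intro p; rfl
  | cons x u ih =>
    intro p
    rw [extendPast, ih, T.pastState_eq_trans h (consSeq x p)]
    rfl

/-- Letters read in the future can be absorbed into the past; this expresses the action on future
sequences through `leftAct`. -/
theorem stateAt_pastState (T : Transducer n) (h : T.StronglySync) (p x : ℕ → Fin n) (i : ℕ) :
    T.stateAt (T.pastState h p) x i =
      T.pastState h (extendPast p ((List.range i).map x)) := by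
  induction i with
  | zero => rfl
  | succ i ih =>
    rw [stateAt, ih, pastState_extendPast, pastState_extendPast, List.range_succ, List.map_append,
      run_append]
    rfl

/-- A core state is the end state of some word read from anywhere, so any past ending in that word
leads to it. -/
theorem pastState_surjective (T : Transducer n) (h : T.IsCore) :
    Function.Surjective (T.pastState h.1) := by
  intro q
  obtain ⟨w, -, hw⟩ := exists_word_of_mem_coreSet (h.2.ge (Set.mem_univ q)) 0
  exact ⟨extendPast (fun _ => 0) w, by rw [pastState_extendPast, hw]⟩

/-- The map of the left-infinite sequences induced by a strongly synchronizing transducer. -/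
noncomputable def leftAct (T : Transducer n) (h : T.StronglySync) (p : ℕ → Fin n) : ℕ → Fin n :=
  fun i => T.out (p i) (T.pastState h ((shift n)^[i + 1] p))

theorem leftAct_shift (T : Transducer n) (h : T.StronglySync) (p : ℕ → Fin n) :
    T.leftAct h (shift n p) = shift n (T.leftAct h p) := rfl

theorem leftAct_iterate_shift (T : Transducer n) (h : T.StronglySync) (p : ℕ → Fin n) (i : ℕ) :
    T.leftAct h ((shift n)^[i] p) = (shift n)^[i] (T.leftAct h p) :=
  Function.Semiconj.iterate_right (f := T.leftAct h) (T.leftAct_shift h) i p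

theorem leftAct_consSeq (T : Transducer n) (h : T.StronglySync) (x : Fin n) (p : ℕ → Fin n) :
    T.leftAct h (consSeq x p) = consSeq (T.out x (T.pastState h p)) (T.leftAct h p) := by
  funext i
  cases i <;> rfl

theorem leftAct_extendPast (T : Transducer n) (h : T.StronglySync) (u : List (Fin n)) :
    ∀ p : ℕ → Fin n, T.leftAct h (extendPast p u) =
      extendPast (T.leftAct h p) (T.outWord u (T.pastState h p)) := by
  induction u with
  | nil => intro p; rfl
  | cons x u ih =>
    intro p
    rw [extendPast, ih, leftAct_consSeq, T.pastState_eq_trans h (consSeq x p)]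
    rfl

theorem recent_leftAct (T : Transducer n) (h : T.StronglySync) (l : ℕ) : ∀ p : ℕ → Fin n,
    recent (T.leftAct h p) l = T.outWord (recent p l) (T.pastState h ((shift n)^[l] p)) := by
  induction l with
  | zero => intro p; rfl
  | succ l ih =>
    intro p
    rw [recent, ← leftAct_shift, ih, recent, outWord_append, Function.iterate_succ_apply,
      run_recent_pastState]
    rfl

theorem pastState_prod (T U : Transducer n) (hT : T.StronglySync) (hU : U.StronglySync)
    (p : ℕ → Fin n) : (T.prod U).pastState (hT.prod hU) p =
      (T.pastState hT p, U.pastState hU (T.leftAct hT p)) := by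
  obtain ⟨k, hk⟩ := id (hT.prod hU)
  obtain ⟨j, hj⟩ := id hU
  obtain ⟨b⟩ := hU.nonempty
  -- The initial state is free; with the true past state of `T` as first component, the word passed
  -- to `U` is a final segment of `T.leftAct hT p`, long enough to synchronize `U`.
  rw [pastState_eq _ (hk.mono (le_max_left k j)) p (T.pastState hT ((shift n)^[max k j] p), b),
    run_prod, run_recent_pastState, ← recent_leftAct, pastState_eq hU (hj.mono (le_max_right k j))]

theorem leftAct_prod (T U : Transducer n) (hT : T.StronglySync) (hU : U.StronglySync)
    (p : ℕ → Fin n) :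
    (T.prod U).leftAct (hT.prod hU) p = U.leftAct hU (T.leftAct hT p) := by
  funext i
  rw [leftAct, pastState_prod T U hT hU, leftAct_iterate_shift]
  rfl

/-- One pair of equivalent states suffices: both transducers may be started there, and equivalence
persists along every word, in particular along synchronizing ones. -/
theorem leftAct_congr {A B : Transducer n} (hA : A.StronglySync) (hB : B.StronglySync) {a : A.Q}
    {b : B.Q} (h : A.act a = B.act b) : A.leftAct hA = B.leftAct hB := by
  funext p i
  obtain ⟨k, hk⟩ := id hA
  obtain ⟨j, hj⟩ := id hB
  rw [leftAct, leftAct, out_eq_act, out_eq_act, pastState_eq hA (hk.mono (le_max_left k j)) _ a,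
    pastState_eq hB (hj.mono (le_max_right k j)) _ b, act_run_congr _ h]

theorem act_pastState (T : Transducer n) (h : T.StronglySync) (p x : ℕ → Fin n) (i : ℕ) :
    T.act (T.pastState h p) x i =
      T.leftAct h (consSeq (x i) (extendPast p ((List.range i).map x))) 0 := by
  rw [act, stateAt_pastState]
  rfl

/-- Each letter written by a past state is the letter at position 0 of `leftAct` on the past
extended by the input read so far, so `leftAct` determines the state's whole action. -/
theorem act_pastState_congr {A B : Transducer n} (hA : A.StronglySync) (hB : B.StronglySync)
    (h : A.leftAct hA = B.leftAct hB) (p : ℕ → Fin n) :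
    A.act (A.pastState hA p) = B.act (B.pastState hB p) := by
  funext x i
  rw [act_pastState, act_pastState, h]

theorem continuous_run_recent {n : ℕ} {T : Transducer n} [TopologicalSpace T.Q] [DiscreteTopology T.Q]
    (q : T.Q) (l : ℕ) : Continuous (fun p : ℕ → Fin n => T.run (recent p l) q) := by
  induction l with
  | zero => exact continuous_const
  | succ l ih =>
    have h : Continuous (shift n) := continuous_pi fun i => continuous_apply (i + 1)
    have h2 : Continuous (fun z : Fin n × T.Q => T.trans z.1 z.2) := continuous_of_discreteTopology
    have : (fun p : ℕ → Fin n => T.run (recent p (l + 1)) q) =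
        fun p => T.trans (p 0) (T.run (recent (shift n p) l) q) := by
      funext p
      rw [recent, run_append]
      rfl
    rw [this]
    exact h2.comp ((continuous_apply 0).prodMk (ih.comp h))

theorem continuous_leftAct (T : Transducer n) (h : T.StronglySync) :
    Continuous (T.leftAct h) := by
  let : TopologicalSpace T.Q := ⊥
  have : DiscreteTopology T.Q := ⟨rfl⟩
  have hs : Continuous (shift n) := continuous_pi fun i => continuous_apply (i + 1)
  have h2 : Continuous (fun z : Fin n × T.Q => T.out z.1 z.2) := continuous_of_discreteTopology
  exact continuous_pi fun i => h2.comp ((continuous_apply i).prodMk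
    ((continuous_run_recent _ _).comp (hs.iterate (i + 1))))

end Transducer

/-! ### The faithful action of transducer classes on left-infinite sequences. -/

namespace SyncMonoid

open Transducer

variable {n : ℕ} [n.AtLeastTwo]

/-- The map of the left-infinite sequences induced by an element of the monoid of transducers. -/
noncomputable def leftAct : SyncMonoid n → (ℕ → Fin n) → ℕ → Fin n :=
  Quotient.lift (fun T => T.1.leftAct T.2.1.1) (by
    rintro T U ⟨f, hf⟩
    obtain ⟨q⟩ := T.2.1.1.nonempty
    exact leftAct_congr _ _ (hf q))

theorem leftAct_toClass (A : Transducer n) (hA : A.StronglySync) :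
    (A.toClass hA).leftAct = A.leftAct hA := by
  obtain ⟨a, b, h⟩ := A.exists_reduce_act hA
  exact leftAct_congr _ _ h

theorem leftAct_mul (P Q : SyncMonoid n) : (P * Q).leftAct = Q.leftAct ∘ P.leftAct := by
  induction P using Quotient.inductionOn with | _ T =>
  induction Q using Quotient.inductionOn with | _ U =>
  exact (leftAct_toClass _ _).trans (funext (leftAct_prod _ _ T.2.1.1 U.2.1.1))

theorem leftAct_shift (P : SyncMonoid n) (p : ℕ → Fin n) :
    P.leftAct (shift n p) = shift n (P.leftAct p) := by
  induction P using Quotient.inductionOn with | _ T => rfl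

theorem continuous_leftAct (P : SyncMonoid n) : Continuous P.leftAct := by
  induction P using Quotient.inductionOn with | _ T => exact T.1.continuous_leftAct _

theorem leftAct_injective : Function.Injective (leftAct (n := n)) := by
  intro P Q h
  induction P using Quotient.inductionOn with | _ T =>
  induction Q using Quotient.inductionOn with | _ U =>
  -- The constant past yields one pair of equivalent states, which already forces equal classes.
  have key := act_pastState_congr T.2.1.1 U.2.1.1 h (fun _ => 0)
  exact (toClass_self T).symm.trans ((toClass_eq _ _ key).trans (toClass_self U))

end SyncMonoid

/-! ### De Bruijn transducers -/

namespace Transducer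

/-- The transducer whose states are the blocks of length `k`, which remembers the last `k` letters
and writes the value of the block map `f` on the last `k + 1` letters. -/
abbrev deBruijn {n k : ℕ} (f : (Fin (k + 1) → Fin n) → Fin n) : Transducer n where
  Q := Fin k → Fin n
  finite_Q := inferInstance
  trans x a := fun j => Fin.snoc (α := fun _ => Fin n) a x j.succ
  out x a := f (Fin.snoc a x)

variable {n k : ℕ}

theorem run_deBruijn (f : (Fin (k + 1) → Fin n) → Fin n) (a : Fin k → Fin n) (l : ℕ) :
    ∀ (p : ℕ → Fin n) (j : Fin k), k - 1 - j < l →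
      (deBruijn f).run (recent p l) a j = p (k - 1 - j) := by
  induction l with
  | zero => intro p j h; omega
  | succ l ih =>
    intro p j h
    rw [recent, run_append]
    change Fin.snoc (α := fun _ => Fin n) ((deBruijn f).run (recent (shift n p) l) a) (p 0) j.succ
      = _
    by_cases hj : (j : ℕ) + 1 < k
    · have : j.succ = Fin.castSucc ⟨j + 1, hj⟩ := Fin.ext (by simp)
      rw [this, Fin.snoc_castSucc, ih _ _ (by simp only; omega), shift]
      congr 1
      simp only
      omega
    · have : j.succ = Fin.last k := Fin.ext (by simp; omega)
      rw [this, Fin.snoc_last, show k - 1 - (j : ℕ) = 0 by omega]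

theorem run_deBruijn_recent (f : (Fin (k + 1) → Fin n) → Fin n) (a : Fin k → Fin n)
    (p : ℕ → Fin n) : (deBruijn f).run (recent p k) a = fun j : Fin k => p (k - 1 - j) :=
  funext fun j => run_deBruijn f a k p j (by omega)

variable [n.AtLeastTwo]

theorem syncAt_deBruijn (f : (Fin (k + 1) → Fin n) → Fin n) : (deBruijn f).SyncAt k := by
  have : Nonempty (deBruijn f).Q := ⟨(fun _ => 0 : Fin k → Fin n)⟩
  refine syncAt_of_forall fun w hw p q => ?_
  -- The word is written as the end of a left-infinite sequence so that `run_deBruijn_recent`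
  -- applies; the filler 0 is never seen.
  have h := recent_extendPast_length (fun _ => 0) w
  rw [hw] at h
  rw [← h]
  exact (run_deBruijn_recent f p _).trans (run_deBruijn_recent f q _).symm

theorem deBruijn_stronglySync (f : (Fin (k + 1) → Fin n) → Fin n) : (deBruijn f).StronglySync :=
  ⟨k, syncAt_deBruijn f⟩

theorem leftAct_deBruijn_zero (f : (Fin (k + 1) → Fin n) → Fin n) (p : ℕ → Fin n) :
    (deBruijn f).leftAct (deBruijn_stronglySync f) p 0 = f (fun j => p (k - j)) := by
  rw [leftAct, pastState_eq _ (syncAt_deBruijn f) _ (fun _ => 0 : Fin k → Fin n)]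
  change f (Fin.snoc _ (p 0)) = _
  rw [run_deBruijn_recent]
  congr 1
  funext j
  refine Fin.lastCases ?_ (fun j => ?_) j
  · rw [Fin.snoc_last]; simp
  · rw [Fin.snoc_castSucc]
    change p _ = p _
    congr 1
    simp only [Fin.val_castSucc]
    omega

theorem deBruijn_invertible {n k : ℕ} {f : (Fin (k + 1) → Fin n) → Fin n} (hf : RightPermutive f) :
    (deBruijn f).Invertible := hf

/-! ### Homeomorphism states and invertibility -/

/-- Only surjectivity matters: a state reaching every constant sequence writes every letter first,
and a surjection of a finite alphabet is a bijection. -/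
theorem invertible_of_isHomeomorph {n : ℕ} {T : Transducer n} (h : ∀ q, IsHomeomorph (T.act q)) :
    T.Invertible := by
  intro q
  refine Finite.surjective_iff_bijective.1 fun y => ?_
  obtain ⟨x, hx⟩ := (h q).surjective (fun _ => y)
  exact ⟨x 0, congrFun hx 0⟩

theorem Invertible.isHomeomorph_reduce {n : ℕ} {T : Transducer n} (h : T.Invertible)
    (hs : T.StronglySync) (q : (T.reduce hs).1.Q) : IsHomeomorph ((T.reduce hs).1.act q) := by
  obtain ⟨b, hb⟩ := (range_act_reduce T hs).le ⟨q, rfl⟩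
  rw [← hb, act_core]
  exact h.isHomeomorph _

/-- At a synchronization level `k`, the first `k` letters of a window fix the state and the last one
is read in it; permutivity in the last letter is invertibility of that state. -/
theorem exists_slide_eq (T : Transducer n) (h : T.StronglySync) (hi : T.Invertible) :
    ∃ (k : ℕ) (f : (Fin (k + 1) → Fin n) → Fin n), RightPermutive f ∧
      ∀ p, T.leftAct h p 0 = f (fun j => p (k - j)) := by
  obtain ⟨k, hk⟩ := id h
  obtain ⟨q⟩ := h.nonempty
  refine ⟨k, fun z => T.out (z (Fin.last k)) (T.run (List.ofFn (fun j : Fin k => z j.castSucc)) q),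
    fun a => ?_, fun p => ?_⟩
  · simpa using hi (T.run (List.ofFn a) q)
  · rw [leftAct, pastState_eq h hk _ q, recent_eq_ofFn]
    simp only [Fin.val_last, Nat.sub_self, Fin.val_castSucc, Nat.zero_add, Function.iterate_one, shift]
    congr 4
    funext j
    congr 1
    omega

end Transducer

/-! ### The monoid of sliding block maps -/

/-- The map of the bi-infinite sequences induced by a map of the left-infinite sequences. -/
def biLift {n : ℕ} (φ : (ℕ → Fin n) → ℕ → Fin n) (x : ℤ → Fin n) : ℤ → Fin n :=
  fun i => φ (fun k => x (i - k)) 0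

/-- Commuting with the shift identifies `φ` of the past at `i` with the past at `i` of the lifted
image. -/
theorem biLift_comp {n : ℕ} (φ ψ : (ℕ → Fin n) → ℕ → Fin n)
    (hφ : ∀ p, φ (shift n p) = shift n (φ p)) : biLift (ψ ∘ φ) = biLift ψ ∘ biLift φ := by
  funext x i
  have h : φ (fun k => x (i - k)) = fun j : ℕ => biLift φ x (i - j) := by
    funext j
    have h1 : φ ((shift n)^[j] fun k => x (i - k)) = (shift n)^[j] (φ fun k => x (i - k)) :=
      Function.Semiconj.iterate_right (f := φ) hφ j _
    have h2 : ∀ (j : ℕ) (p : ℕ → Fin n) (k : ℕ), (shift n)^[j] p k = p (k + j) := by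
      intro j
      induction j with
      | zero => intro p k; rfl
      | succ j ih => intro p k; rw [Function.iterate_succ_apply, ih]; rfl
    have h3 := congrFun h1 0
    rw [h2, Nat.zero_add] at h3
    rw [← h3, biLift]
    congr 1
    funext k
    rw [h2]
    congr 1
    push_cast
    ring
  change ψ (φ _) 0 = ψ _ 0
  rw [h]

theorem biLift_injective {n : ℕ} {φ ψ : (ℕ → Fin n) → ℕ → Fin n}
    (hφ : ∀ p, φ (shift n p) = shift n (φ p)) (hψ : ∀ p, ψ (shift n p) = shift n (ψ p))
    (h : biLift φ = biLift ψ) : φ = ψ := by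
  have h0 : ∀ p, φ p 0 = ψ p 0 := by
    intro p
    -- Any bi-infinite sequence with past `p` at position 0 serves; truncation by `toNat` puts `p 0`
    -- at all positive positions.
    have := congrFun (congrFun h (fun i => p (-i).toNat)) 0
    simpa [biLift] using this
  funext p i
  induction i generalizing p with
  | zero => exact h0 p
  | succ i ih =>
    have := ih (shift n p)
    rwa [hφ, hψ] at this

theorem biLift_eq_slide {n k : ℕ} {φ : (ℕ → Fin n) → ℕ → Fin n}
    {f : (Fin (k + 1) → Fin n) → Fin n} (h : ∀ p, φ p 0 = f (fun j => p (k - j))) :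
    biLift φ = slide f := by
  funext x i
  rw [biLift, h, slide]
  congr 1
  funext j
  congr 1
  rw [Nat.cast_sub (by omega)]
  push_cast
  ring

/-- The homomorphism that sends a transducer to its action on the bi-infinite sequences. -/
noncomputable def biAct (n : ℕ) [n.AtLeastTwo] : SH n →* RF n where
  toFun P := ⟨MulOpposite.op (biLift P.1.leftAct), by
    obtain ⟨_, T, rfl, hT⟩ := P
    obtain ⟨k, f, hf, h⟩ := T.1.exists_slide_eq T.2.1.1 (Transducer.invertible_of_isHomeomorph hT)
    exact ⟨k, f, hf, congrArg MulOpposite.op (biLift_eq_slide h)⟩⟩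
  map_one' := by
    apply Subtype.ext
    apply MulOpposite.unop_injective
    funext x i
    change x (i - (0 : ℕ)) = x i
    simp
  map_mul' P Q := by
    apply Subtype.ext
    apply MulOpposite.unop_injective
    change biLift (P.1 * Q.1).leftAct = biLift Q.1.leftAct ∘ biLift P.1.leftAct
    rw [SyncMonoid.leftAct_mul, biLift_comp _ _ P.1.leftAct_shift]

theorem biAct_bijective (n : ℕ) [n.AtLeastTwo] : Function.Bijective (biAct n) := by
  constructor
  · intro P Q h
    have := congrArg (fun F => MulOpposite.unop F.1) h
    exact Subtype.ext (SyncMonoid.leftAct_injective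
      (biLift_injective P.1.leftAct_shift Q.1.leftAct_shift this))
  · rintro ⟨_, k, f, hf, rfl⟩
    have hs := Transducer.deBruijn_stronglySync f
    refine ⟨⟨(Transducer.deBruijn f).toClass hs, _, rfl,
      (Transducer.deBruijn_invertible hf).isHomeomorph_reduce hs⟩, ?_⟩
    apply Subtype.ext
    apply MulOpposite.unop_injective
    change biLift ((Transducer.deBruijn f).toClass hs).leftAct = slide f
    rw [SyncMonoid.leftAct_toClass]
    exact biLift_eq_slide (Transducer.leftAct_deBruijn_zero f)

/-! ### Automorphisms of the one-sided shift -/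

/-- Each point has a cylinder on which `g` is constant; finitely many of these cover the compact
space, and their largest depth is a common window. -/
theorem exists_window {n : ℕ} {g : (ℕ → Fin n) → Fin n} (hg : Continuous g) :
    ∃ m, ∀ p q : ℕ → Fin n, (∀ i < m, p i = q i) → g p = g q := by
  have key : ∀ p : ℕ → Fin n, ∃ m, ∀ q ∈ PiNat.cylinder p m, g q = g p := by
    intro p
    have ho : IsOpen (g ⁻¹' {g p}) := (isOpen_discrete _).preimage hg
    obtain ⟨_, ⟨y, m, rfl⟩, hy, hm⟩ :=
      (PiNat.isTopologicalBasis_cylinders fun _ : ℕ => Fin n).exists_subset_of_mem_open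
        (show p ∈ g ⁻¹' {g p} from rfl) ho
    rw [← PiNat.mem_cylinder_iff_eq.1 hy] at hm
    exact ⟨m, fun q hq => hm hq⟩
  choose m hm using key
  obtain ⟨t, ht⟩ := isCompact_univ.elim_finite_subcover (fun p => PiNat.cylinder p (m p))
    (fun p => PiNat.isOpen_cylinder _ p _)
    (fun p _ => Set.mem_iUnion.2 ⟨p, PiNat.self_mem_cylinder p _⟩)
  refine ⟨t.sup m, fun p q h => ?_⟩
  obtain ⟨y, hy, hpy⟩ := Set.mem_iUnion₂.1 (ht (Set.mem_univ p))
  have hq : q ∈ PiNat.cylinder y (m y) := fun i hi =>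
    (h i (hi.trans_le (Finset.le_sup hy))).symm.trans (hpy i hi)
  rw [hm y p hpy, hm y q hq]

theorem exists_blockMap {n : ℕ} {φ : (ℕ → Fin n) → ℕ → Fin n} (hφ : Continuous φ) :
    ∃ (k : ℕ) (f : (Fin (k + 1) → Fin n) → Fin n), ∀ p, φ p 0 = f (fun j => p (k - j)) := by
  obtain ⟨k, hk⟩ := exists_window (show Continuous fun p => φ p 0 by fun_prop)
  -- The block is stored oldest letter first. Beyond depth `k` truncated subtraction repeats its
  -- oldest letter, outside the window on which the value depends.
  refine ⟨k, fun z => φ (fun i => z ⟨k - i, by omega⟩) 0, fun p => hk _ _ fun i hi => ?_⟩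
  simp only
  congr 1
  omega

/-- If a block map gave equal values on `a x` and `a y`, two pasts differing only in their last
letter would have equal images: the older letters of both images come from the common older past.
Injectivity thus gives right permutivity, and the de Bruijn transducer is invertible. -/
theorem exists_leftAct_eq {n : ℕ} [n.AtLeastTwo] {φ : (ℕ → Fin n) → ℕ → Fin n}
    (hφ : Continuous φ) (hs : ∀ p, φ (shift n p) = shift n (φ p)) (hi : Function.Injective φ) :
    ∃ (T : Transducer n) (h : T.StronglySync), T.Invertible ∧ T.leftAct h = φ := by
  obtain ⟨k, f, hf⟩ := exists_blockMap hφ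
  refine ⟨Transducer.deBruijn f, Transducer.deBruijn_stronglySync f,
    Transducer.deBruijn_invertible fun a => Finite.injective_iff_bijective.1 fun x y h => ?_,
    biLift_injective (Transducer.leftAct_shift _ _) hs ?_⟩
  -- A past ending in the block `a`: truncated subtraction repeats the oldest letter of `a` further
  -- back, and the default 0 is used only when `k = 0`.
  · let p : ℕ → Fin n := fun i => if h : k - 1 - i < k then a ⟨k - 1 - i, h⟩ else 0
    have key : ∀ x, φ (Transducer.consSeq x p) 0 = f (Fin.snoc a x) := by
      intro x
      rw [hf]
      congr 1
      funext j
      refine Fin.lastCases ?_ (fun j => ?_) j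
      · rw [Fin.snoc_last]
        simp [Transducer.consSeq]
      · rw [Fin.snoc_castSucc]
        have : k - (j.castSucc : ℕ) = (k - 1 - j) + 1 := by simp; omega
        rw [this, Transducer.consSeq]
        simp only [p]
        rw [dif_pos (by omega)]
        congr 1
        apply Fin.ext
        simp only
        omega
    have h0 : φ (Transducer.consSeq x p) = φ (Transducer.consSeq y p) := by
      funext i
      cases i with
      | zero => rw [key, key]; exact h
      | succ i =>
        have hx := congrFun (hs (Transducer.consSeq x p)) i
        have hy := congrFun (hs (Transducer.consSeq y p)) i
        exact hx.symm.trans hy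
    exact congrFun (hi h0) 0
  · rw [biLift_eq_slide (Transducer.leftAct_deBruijn_zero f), biLift_eq_slide hf]

/-! ### Synchronization of the inverse transducer. -/

namespace Transducer

variable {n : ℕ} [n.AtLeastTwo]

theorem run_outWord_inv {n : ℕ} (T : Transducer n) (h : T.Invertible) (w : List (Fin n)) :
    ∀ q : T.Q, T.run ((T.inv h).outWord w q) q = (T.inv h).run w q := by
  induction w with
  | nil => intro q; rfl
  | cons x w ih => intro q; exact ih _

theorem outWord_outWord_inv {n : ℕ} (T : Transducer n) (h : T.Invertible) (w : List (Fin n)) :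
    ∀ q : T.Q, T.outWord ((T.inv h).outWord w q) q = w := by
  induction w with
  | nil => intro q; rfl
  | cons x w ih =>
    intro q
    exact congrArg₂ _ (T.out_perm_symm h q x) (ih _)

/-- An invertible core transducer is bi-synchronizing if its action on the left-infinite sequences
is undone by some strongly synchronizing transducer. -/
theorem inv_stronglySync_of_leftInverse {T U : Transducer n} (hT : T.IsCore)
    (hU : U.StronglySync) (hi : T.Invertible)
    (h : Function.LeftInverse (U.leftAct hU) (T.leftAct hT.1)) : (T.inv hi).StronglySync := by
  have : Nonempty (T.inv hi).Q := hT.1.nonempty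
  have hUT := hU.prod hT.1
  obtain ⟨k, hk⟩ := id hUT
  obtain ⟨c⟩ := hUT.nonempty
  -- With `q` the state after a past `p`, let `v` be what the inverse writes on `w` from `q`. The
  -- image of the past `p v` under `T` ends in `w`. Applied to this image, `U` gives back `p v`, so
  -- the second component of the product `U.prod T` is the state of `T` after `p v`, which is where
  -- the inverse arrives after `w`. Synchronization of the product makes it a function of `w`.
  have key : ∀ w : List (Fin n), w.length = k → ∀ q,
      (T.inv hi).run w q = ((U.prod T).run w c).2 := by
    intro w hw q
    obtain ⟨p, rfl⟩ := T.pastState_surjective hT q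
    have h1 := pastState_prod U T hU hT.1
      (T.leftAct hT.1 (extendPast p ((T.inv hi).outWord w (T.pastState hT.1 p))))
    rw [h, pastState_extendPast, run_outWord_inv, leftAct_extendPast, outWord_outWord_inv,
      pastState_eq _ hk _ c] at h1
    subst hw
    rw [recent_extendPast_length] at h1
    rw [h1]
  exact ⟨k, syncAt_of_forall fun w hw p q => (key w hw p).trans (key w hw q).symm⟩

end Transducer

/-! ### The bi-synchronizing group as the automorphism group of the one-sided shift. -/

section ShiftAut

variable {n : ℕ} [n.AtLeastTwo]

theorem leftAct_mul_apply (P Q : HGroup n) (p : ℕ → Fin n) :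
    (P * Q).1.leftAct p = Q.1.leftAct (P.1.leftAct p) :=
  congrFun (SyncMonoid.leftAct_mul P.1 Q.1) p

/-- The action of `H_n` on the left-infinite sequences. As transducers compose from left to right
and homeomorphisms from right to left, the inverse transducer is used. -/
noncomputable def toShiftAut (n : ℕ) [n.AtLeastTwo] : HGroup n →* ShiftAut n where
  toFun P := ⟨{
    toFun := (P⁻¹).1.leftAct
    invFun := P.1.leftAct
    left_inv p := by
      rw [← leftAct_mul_apply, inv_mul_cancel]
      rfl
    right_inv p := by
      rw [← leftAct_mul_apply, mul_inv_cancel]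
      rfl
    continuous_toFun := (P⁻¹).1.continuous_leftAct
    continuous_invFun := P.1.continuous_leftAct }, (P⁻¹).1.leftAct_shift⟩
  map_one' := by
    apply Subtype.ext
    apply Homeomorph.ext
    intro p
    change ((1 : HGroup n)⁻¹).1.leftAct p = p
    rw [inv_one]
    rfl
  map_mul' P Q := by
    apply Subtype.ext
    apply Homeomorph.ext
    intro p
    change ((P * Q)⁻¹).1.leftAct p = (P⁻¹).1.leftAct ((Q⁻¹).1.leftAct p)
    rw [mul_inv_rev, leftAct_mul_apply]

theorem toShiftAut_bijective (n : ℕ) [n.AtLeastTwo] : Function.Bijective (toShiftAut n) := by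
  constructor
  · intro P Q h
    have h1 : (P⁻¹).1.leftAct = (Q⁻¹).1.leftAct := congrArg (fun g => (g.1 : _ → _)) h
    exact inv_injective (Subtype.ext (SyncMonoid.leftAct_injective h1))
  · rintro ⟨g, hg⟩
    obtain ⟨T, hT, iT, hTg⟩ := exists_leftAct_eq g.continuous hg g.injective
    obtain ⟨U, hU, -, hUg⟩ := exists_leftAct_eq g.symm.continuous
      ((ShiftAut n).inv_mem hg) g.symm.injective
    -- The reduced transducer replaces the de Bruijn one because the inverse criterion needs a core
    -- transducer; the action is unchanged.
    have hr : (T.reduce hT).1.leftAct (T.reduce hT).2.1.1 = g :=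
      (SyncMonoid.leftAct_toClass T hT).trans hTg
    have iR := Transducer.invertible_of_isHomeomorph (iT.isHomeomorph_reduce hT)
    have hR := Transducer.inv_stronglySync_of_leftInverse (T.reduce hT).2.1 hU iR (by
      rw [hr, hUg]
      exact g.symm_apply_apply)
    let P : HGroup n := ⟨T.toClass hT, _, rfl, (T.reduce hT).2.1.1, iR, hR⟩
    refine ⟨P⁻¹, Subtype.ext (Homeomorph.ext fun p => ?_)⟩
    change ((P⁻¹)⁻¹).1.leftAct p = g p
    rw [inv_inv]
    exact congrFun hr p

end ShiftAut

/-! ### The action on the Cantor space and the Higman–Thompson groups -/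

namespace Transducer

variable {n : ℕ}

/-- The action of a state, as a map of streams. -/
def streamAct (T : Transducer n) (q : T.Q) (w : Stream' (Fin n)) : Stream' (Fin n) :=
  T.act q w

theorem streamAct_append (T : Transducer n) (u : List (Fin n)) (w : Stream' (Fin n)) : ∀ q : T.Q,
    T.streamAct q (u ++ₛ w) = T.outWord u q ++ₛ T.streamAct (T.run u q) w := by
  induction u with
  | nil => intro q; rfl
  | cons x u ih =>
    intro q
    have h : (x :: u ++ₛ w : ℕ → Fin n) = consSeq x (fun i => (u ++ₛ w).get i) := by
      funext i
      cases i <;> rfl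
    rw [streamAct, h]
    funext i
    cases i with
    | zero => rfl
    | succ i =>
      rw [act, stateAt_cons]
      exact congrFun (ih (T.trans x q)) i

theorem inv_streamAct_streamAct (T : Transducer n) (h : T.Invertible) (q : T.Q)
    (w : Stream' (Fin n)) : (T.inv h).streamAct q (T.streamAct q w) = w :=
  T.act_inv_act h q w

theorem streamAct_inv_streamAct (T : Transducer n) (h : T.Invertible) (q : T.Q)
    (w : Stream' (Fin n)) : T.streamAct q ((T.inv h).streamAct q w) = w :=
  T.act_act_inv h q w

/-- The permutation of `C_{n,r}` which acts on each copy of `X_n^ℕ` as the state `q` does. -/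
noncomputable def cantorPerm (r : ℕ) (T : Transducer n) (h : T.Invertible) (q : T.Q) :
    Equiv.Perm (CantorSpace n r) :=
  (Equiv.refl _).prodCongr ⟨T.streamAct q, (T.inv h).streamAct q,
    T.inv_streamAct_streamAct h q, T.streamAct_inv_streamAct h q⟩

theorem cantorPerm_apply {r : ℕ} (T : Transducer n) (h : T.Invertible) (q : T.Q)
    (i : Fin r) (w : Stream' (Fin n)) : T.cantorPerm r h q (i, w) = (i, T.streamAct q w) := rfl

theorem cantorPerm_inv_apply {r : ℕ} (T : Transducer n) (h : T.Invertible) (q : T.Q) (i : Fin r)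
    (w : Stream' (Fin n)) :
    (T.cantorPerm r h q)⁻¹ (i, w) = (i, (T.inv h).streamAct q w) := rfl

theorem cantorPerm_inv {r : ℕ} (T : Transducer n) (h : T.Invertible) (q : T.Q) :
    (T.inv h).cantorPerm r (T.inv_invertible h) q = (T.cantorPerm r h q)⁻¹ :=
  Equiv.ext fun _ => rfl

/-- On a deep cone the inverse writes `a ++ t`, and `g` replaces only `a`. The surviving `t`, of
synchronizing length, brings `T` to the same state as if `a` had not been replaced, which is the
state the inverse has reached; the actions on the tail cancel. -/
theorem conj_cantorPerm_mem {r : ℕ} {T : Transducer n} (hT : T.StronglySync) (h : T.Invertible)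
    (q : T.Q) {g : Equiv.Perm (CantorSpace n r)} (hg : g ∈ HigmanThompson n r) :
    T.cantorPerm r h q * g * (T.cantorPerm r h q)⁻¹ ∈ HigmanThompson n r := by
  obtain ⟨k, hk⟩ := hT
  obtain ⟨m, hm⟩ := hg
  refine ⟨m + k, fun i u hu => ?_⟩
  have hl : ((T.inv h).outWord u q).length = m + k := (length_outWord _ _ _).trans hu
  obtain ⟨a, t, hat, ha⟩ : ∃ a t, (T.inv h).outWord u q = a ++ t ∧ a.length = m :=
    ⟨_, _, (List.take_append_drop m _).symm, by simp [hl]⟩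
  have ht : t.length = k := by
    rw [hat, List.length_append] at hl
    omega
  obtain ⟨j, v, hv⟩ := hm i a ha
  refine ⟨j, T.outWord (v ++ t) q, fun w => ?_⟩
  have hrun : T.run (v ++ t) q = (T.inv h).run u q := by
    rw [← run_outWord_inv, hat, run_append, run_append, hk.run_eq t ht]
  rw [Equiv.Perm.mul_apply, Equiv.Perm.mul_apply, cantorPerm_inv_apply, streamAct_append,
    hat, Stream'.append_append_stream, hv, ← Stream'.append_append_stream, cantorPerm_apply,
    streamAct_append, hrun, streamAct_inv_streamAct]

theorem cantorPerm_mem_normalizer (r : ℕ) {T : Transducer n} (hT : T.StronglySync)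
    (h : T.Invertible) (hi : (T.inv h).StronglySync) (q : T.Q) :
    T.cantorPerm r h q ∈ Subgroup.normalizer (HigmanThompson n r : Set (Equiv.Perm _)) := by
  rw [Subgroup.mem_normalizer_iff]
  refine fun g => ⟨conj_cantorPerm_mem hT h q, fun hg => ?_⟩
  have := conj_cantorPerm_mem hi (T.inv_invertible h) q hg
  rw [cantorPerm_inv] at this
  simpa [mul_assoc] using this

/-- After `k` letters the inverse, though started in `q`, has reached the state from which the tail
is being written, so it undoes the action on that tail. -/
theorem inv_cantorPerm_mul_mem (r : ℕ) {T : Transducer n} (h : T.Invertible)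
    (hi : (T.inv h).StronglySync) (q q' : T.Q) :
    (T.cantorPerm r h q)⁻¹ * T.cantorPerm r h q' ∈ HigmanThompson n r := by
  obtain ⟨k, hk⟩ := hi
  refine ⟨k, fun i u hu => ⟨i, (T.inv h).outWord (T.outWord u q') q, fun w => ?_⟩⟩
  rw [Equiv.Perm.mul_apply, cantorPerm_apply, cantorPerm_inv_apply, streamAct_append,
    streamAct_append, hk.run_eq _ ((length_outWord _ _ _).trans hu) q q', run_inv,
    inv_streamAct_streamAct]

/-- On one cone the state writes `u` and continues as a state `p`, while the table writes `v` and
copies the tail. Equal lengths of `u` and `v` then force `p` to act as the identity. -/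
theorem exists_act_eq_id [n.AtLeastTwo] {r : ℕ} (hr : 1 ≤ r) {T : Transducer n}
    (h : T.Invertible) (q : T.Q) (hq : T.cantorPerm r h q ∈ HigmanThompson n r) :
    ∃ p : T.Q, T.act p = id := by
  obtain ⟨m, hm⟩ := hq
  obtain ⟨j, v, hv⟩ := hm ⟨0, hr⟩ (List.replicate m 0) (by simp)
  have key : ∀ w : Stream' (Fin n), T.outWord (List.replicate m 0) q ++ₛ
      T.streamAct (T.run (List.replicate m 0) q) w = v ++ₛ w := by
    intro w
    rw [← streamAct_append]
    exact congrArg Prod.snd (hv w)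
  generalize hu : T.outWord (List.replicate m 0) q = u at key
  generalize T.run (List.replicate m 0) q = p at key
  have : Nontrivial (Fin n) := Fin.nontrivial_iff_two_le.2 Nat.AtLeastTwo.prop
  obtain ⟨y, y', h01⟩ := exists_pair_ne (Fin n)
  have hlen : u.length = v.length := by
    rcases lt_trichotomy u.length v.length with hl | hl | hl
    -- A letter of `v` would fix the first output letter of `p`, contradicting surjectivity of its
    -- action.
    · exfalso
      have h1 : ∀ w, (T.streamAct p w).get 0 = v[u.length] := fun w =>
        (Stream'.get_append_length u _).symm.trans
          ((congrArg (fun s => Stream'.get s u.length) (key w)).trans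
            (Stream'.get_append_left _ _ _ hl))
      have h2 := h1 ((T.inv h).streamAct p (Stream'.const y))
      have h3 := h1 ((T.inv h).streamAct p (Stream'.const y'))
      rw [streamAct_inv_streamAct] at h2 h3
      exact h01 (h2.trans h3.symm)
    · exact hl
    -- A letter of `u` would fix the first letter of every input.
    · exfalso
      have h1 : ∀ w : Stream' (Fin n), w.get 0 = u[v.length] := fun w =>
        (Stream'.get_append_length v _).symm.trans
          ((congrArg (fun s => Stream'.get s v.length) (key w)).symm.trans
            (Stream'.get_append_left _ _ _ hl))
      exact h01 ((h1 (Stream'.const y)).trans (h1 (Stream'.const y')).symm)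
  refine ⟨p, funext fun w => ?_⟩
  have huv := Stream'.append_left_injective _ _ _ _ (key w) hlen
  have := key w
  rw [huv] at this
  exact Stream'.append_right_injective _ _ _ this

end Transducer

/-- Some element of `G_{n,r}` maps the cone at `a` to the cone at `b` and fixes the points outside the
two cones. -/
theorem exists_swap_cones {n r m : ℕ} (a b : Fin r × List (Fin n)) (ha : a.2.length = m)
    (hb : b.2.length = m) : ∃ g ∈ HigmanThompson n r,
      (∀ w, g (a.1, a.2 ++ₛ w) = (b.1, b.2 ++ₛ w)) ∧
      ∀ i u w, u.length = m → (i, u) ≠ a → (i, u) ≠ b → g (i, u ++ₛ w) = (i, u ++ₛ w) := by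
  classical
  let e (c : Fin r × List (Fin n)) := Equiv.swap a b c
  -- The permutation of depth-`m` prefixes given by the transposition of `a` and `b`; it is an
  -- involution, hence its own inverse.
  let F : CantorSpace n r → CantorSpace n r := fun x =>
    ((e (x.1, x.2.take m)).1, (e (x.1, x.2.take m)).2 ++ₛ x.2.drop m)
  have hl : ∀ c : Fin r × List (Fin n), c.2.length = m → (e c).2.length = m := by
    intro c hc
    by_cases h1 : c = a
    · subst h1; simpa [e] using hb
    · by_cases h2 : c = b
      · subst h2; simpa [e] using ha
      · simpa [e, Equiv.swap_apply_of_ne_of_ne h1 h2] using hc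
  have hF : ∀ i u w, u.length = m → F (i, u ++ₛ w) = ((e (i, u)).1, (e (i, u)).2 ++ₛ w) := by
    intro i u w hu
    subst hu
    simp only [F]
    rw [Stream'.take_append_of_le_length _ _ _ le_rfl, List.take_length, Stream'.drop_append_stream]
  have hFF : ∀ x, F (F x) = x := by
    rintro ⟨i, x⟩
    have hx : (x.take m).length = m := by simp
    rw [← Stream'.append_take_drop m x, hF _ _ _ hx, hF _ _ _ (hl _ hx)]
    simp [e]
  refine ⟨⟨F, F, hFF, hFF⟩, ⟨m, fun i u hu => ⟨_, _, fun w => hF i u w hu⟩⟩, fun w => ?_,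
    fun i u w hu h1 h2 => ?_⟩
  · exact (hF _ _ _ ha).trans (by simp [e])
  · exact (hF _ _ _ hu).trans (by simp [e, Equiv.swap_apply_of_ne_of_ne h1 h2])

/-- If `z` moves a point, some element of the group fixes the point but moves its image to a third
cone, and so cannot commute with `z`. -/
theorem eq_one_of_commute_higmanThompson {n r : ℕ} [n.AtLeastTwo]
    {z : Equiv.Perm (CantorSpace n r)} (hz : ∀ g ∈ HigmanThompson n r, g * z = z * g) :
    z = 1 := by
  have hn : 2 ≤ n := Nat.AtLeastTwo.prop
  ext1 ⟨i, x⟩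
  by_contra hne
  change z (i, x) ≠ (i, x) at hne
  obtain ⟨⟨j, y⟩, hy⟩ : ∃ c, z (i, x) = c := ⟨_, rfl⟩
  rw [hy] at hne
  -- a depth at which the two points lie in different cones, and at least three cones exist
  obtain ⟨m, hm, hd⟩ : ∃ m, 2 ≤ m ∧ (i, x.take m) ≠ (j, y.take m) := by
    by_cases hij : i = j
    · subst hij
      obtain ⟨k, hk⟩ : ∃ k, x k ≠ y k := by
        by_contra! h
        exact hne (Prod.ext rfl (funext fun k => (h k).symm))
      refine ⟨k + 2, by omega, fun h => hk ?_⟩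
      have h1 := congrArg (fun l => l[k]?) (congrArg Prod.snd h)
      simpa [Stream'.get] using h1
    · exact ⟨2, le_rfl, fun h => hij (congrArg Prod.fst h)⟩
  obtain ⟨c, hc, hcx, hcy⟩ : ∃ c : List (Fin n), c.length = m ∧ (i, c) ≠ (i, x.take m) ∧
      (i, c) ≠ (j, y.take m) := by
    obtain ⟨k, rfl⟩ := Nat.exists_eq_add_of_le hm
    by_contra! h
    have hcard : Fintype.card (List.Vector (Fin n) (2 + k)) ≤ 2 := by
      classical
      have hsub : (Finset.univ : Finset (List.Vector (Fin n) (2 + k))) ⊆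
          {⟨x.take (2 + k), by simp⟩, ⟨y.take (2 + k), by simp⟩} := by
        rintro ⟨c, hc⟩ -
        by_cases h1 : c = x.take (2 + k)
        · exact Finset.mem_insert.2 (Or.inl (Subtype.ext h1))
        · exact Finset.mem_insert.2 (Or.inr (Finset.mem_singleton.2 (Subtype.ext
            (congrArg Prod.snd (h c hc (fun e => h1 (congrArg Prod.snd e)))))))
      exact (Finset.card_le_card hsub).trans Finset.card_le_two
    rw [card_vector, Fintype.card_fin] at hcard
    -- Depth at least 2 leaves at least four cones in the copy `i` alone, so two excluded ones do
    -- not exhaust them.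
    have h1 : 2 ^ 2 ≤ n ^ (2 + k) :=
      (Nat.pow_le_pow_left hn 2).trans (Nat.pow_le_pow_right (by omega) (by omega))
    omega
  obtain ⟨g, hg, hgy, hgx⟩ := exists_swap_cones (j, y.take m) (i, c) (by simp) hc
  have h1 := hgx i (x.take m) (x.drop m) (by simp) hd (Ne.symm hcx)
  have h2 := hgy (y.drop m)
  simp only [Stream'.append_take_drop] at h1 h2
  have h3 := congrArg (fun f => f (i, x)) (hz g hg)
  simp only [Equiv.Perm.mul_apply] at h3
  rw [h1, hy, h2] at h3
  have h4 : (i, c) = (j, y.take m) := by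
    refine Prod.ext (congrArg Prod.fst h3 :) ?_
    refine Stream'.append_left_injective _ _ (y.drop m) (y.drop m) ?_ (by simp [hc])
    rw [Stream'.append_take_drop]
    exact (congrArg Prod.snd h3 :)
  exact hcy h4

/-! ### From the normalizer to outer automorphisms. -/

section OuterAutomorphisms

variable {n : ℕ}

/-- The outer automorphism of `G` induced by an element of its normalizer. -/
def outOfNormalizer {P : Type*} [Group P] (G : Subgroup P) :
    Subgroup.normalizer (G : Set P) →* Out G :=
  (QuotientGroup.mk' _).comp G.normalizerMonoidHom

theorem outOfNormalizer_eq_one_of_mem {P : Type*} [Group P] {G : Subgroup P}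
    {x : Subgroup.normalizer (G : Set P)} (hx : (x : P) ∈ G) : outOfNormalizer G x = 1 :=
  (QuotientGroup.eq_one_iff _).2 ⟨⟨x, hx⟩, MulEquiv.ext fun _ => Subtype.ext rfl⟩

/-- If conjugation by `x` agrees on `G` with conjugation by some `c` in `G`, then the quotient of
`x` by `c` centralizes `G`, hence is trivial. -/
theorem mem_of_outOfNormalizer_eq_one {P : Type*} [Group P] {G : Subgroup P}
    (hG : ∀ z : P, (∀ g ∈ G, g * z = z * g) → z = 1)
    {x : Subgroup.normalizer (G : Set P)} (hx : outOfNormalizer G x = 1) : (x : P) ∈ G := by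
  obtain ⟨c, hc⟩ := (QuotientGroup.eq_one_iff _).1 hx
  have key : (c : P)⁻¹ * x = 1 := by
    refine hG _ fun g hg => ?_
    have h := DFunLike.congr_fun hc (⟨g, hg⟩ : G)
    have h1 : (c : P) * g * (c : P)⁻¹ = x * g * (x : P)⁻¹ := congrArg Subtype.val h
    calc g * ((c : P)⁻¹ * x) = (c : P)⁻¹ * (c * g * (c : P)⁻¹) * x := by group
      _ = (c : P)⁻¹ * x * g := by rw [h1]; group
  rw [← inv_mul_eq_one.1 key]
  exact c.2

/-- The outer automorphism of `G_{n,r}` induced by a state of a bi-synchronizing transducer. -/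
noncomputable def stateOut (r : ℕ) (T : Transducer n) (hT : T.BiSync) (q : T.Q) :
    Out (HigmanThompson n r) :=
  outOfNormalizer _ ⟨_, T.cantorPerm_mem_normalizer r hT.1 hT.2.choose hT.2.choose_spec q⟩

theorem stateOut_eq (r : ℕ) {T : Transducer n} (hT : T.BiSync) (q q' : T.Q) :
    stateOut r T hT q = stateOut r T hT q' := by
  rw [← inv_mul_eq_one, stateOut, stateOut, ← map_inv, ← map_mul]
  exact outOfNormalizer_eq_one_of_mem
    (Transducer.inv_cantorPerm_mul_mem r hT.2.choose hT.2.choose_spec q q')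

theorem stateOut_congr (r : ℕ) {A B : Transducer n} (hA : A.BiSync) (hB : B.BiSync) {a : A.Q}
    {b : B.Q} (h : A.act a = B.act b) : stateOut r A hA a = stateOut r B hB b := by
  refine congrArg (outOfNormalizer _) (Subtype.ext (Equiv.ext fun x => ?_))
  exact Prod.ext rfl (congrFun h x.2)

/-- The order reverses: transducers compose from left to right, permutations from right to left. -/
theorem stateOut_prod [n.AtLeastTwo] (r : ℕ) {A B : Transducer n} (hA : A.BiSync) (hB : B.BiSync)
    (a : A.Q) (b : B.Q) : stateOut r (A.prod B) (hA.prod hB) (a, b) =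
      stateOut r B hB b * stateOut r A hA a := by
  rw [stateOut, stateOut, stateOut, ← map_mul]
  refine congrArg (outOfNormalizer _) (Subtype.ext (Equiv.ext fun x => ?_))
  exact Prod.ext rfl (congrFun (Transducer.act_prod A B a b) x.2)

variable [n.AtLeastTwo]

/-- The outer automorphism of `G_{n,r}` induced by an element of `H_n`. -/
noncomputable def hOut (r : ℕ) (P : HGroup n) : Out (HigmanThompson n r) :=
  stateOut r P.2.choose.1 P.2.choose_spec.2 P.2.choose_spec.2.1.nonempty.some

/-- Removes the choices in `hOut`: neither the representative of the class nor its state matters,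
and the representative need not be core or weakly minimal. -/
theorem hOut_eq (r : ℕ) (P : HGroup n) {T : Transducer n} (hT : T.BiSync) (q : T.Q)
    (h : T.toClass hT.1 = P.1) : hOut r P = stateOut r T hT q := by
  obtain ⟨a, b, hab⟩ := T.exists_reduce_act hT.1
  obtain ⟨f, hf⟩ := Quotient.exact (P.2.choose_spec.1.trans h.symm)
  rw [stateOut_eq r hT q b, ← stateOut_congr r hT.reduce hT hab,
    stateOut_eq r hT.reduce a (f P.2.choose_spec.2.1.nonempty.some)]
  exact stateOut_congr r _ _ (hf _)

theorem exists_toClass_of_hGroup (P : HGroup n) :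
    ∃ (T : Transducer n) (hT : T.BiSync), T.toClass hT.1 = P.1 := by
  obtain ⟨T, h, hT⟩ := P.2
  exact ⟨T.1, hT, (Transducer.toClass_self T).trans h⟩

theorem hOut_mul (r : ℕ) (P Q : HGroup n) : hOut r (P * Q) = hOut r Q * hOut r P := by
  obtain ⟨A, hA, hP⟩ := exists_toClass_of_hGroup P
  obtain ⟨B, hB, hQ⟩ := exists_toClass_of_hGroup Q
  obtain ⟨a⟩ := hA.1.nonempty
  obtain ⟨b⟩ := hB.1.nonempty
  rw [hOut_eq r P hA a hP, hOut_eq r Q hB b hQ, ← stateOut_prod]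
  refine hOut_eq r _ _ _ ((SyncMonoid.mul_toClass hA.1 hB.1).symm.trans ?_)
  rw [hP, hQ]
  rfl

theorem eq_one_of_hOut_eq_one {r : ℕ} (hr : 1 ≤ r) {P : HGroup n} (h : hOut r P = 1) :
    P = 1 := by
  obtain ⟨A, hA, hP⟩ := exists_toClass_of_hGroup P
  obtain ⟨a⟩ := hA.1.nonempty
  rw [hOut_eq r P hA a hP] at h
  obtain ⟨p, hp⟩ := Transducer.exists_act_eq_id hr hA.2.choose a
    (mem_of_outOfNormalizer_eq_one (fun _ => eq_one_of_commute_higmanThompson) h)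
  apply Subtype.ext
  rw [← hP]
  exact (Transducer.toClass_eq (b := ()) _ (Transducer.one_isCore n).1 hp).trans
    (Transducer.toClass_self ⟨_, Transducer.one_isCore n, Transducer.one_weaklyMinimal n⟩)

/-- The homomorphism from `H_n` to the outer automorphism group of `G_{n,r}`. -/
noncomputable def hOutHom (n r : ℕ) [n.AtLeastTwo] : HGroup n →* Out (HigmanThompson n r) :=
  -- Inversion turns the order-reversing `hOut` into a homomorphism.
  MonoidHom.mk' (fun P => hOut r P⁻¹) fun P Q => by rw [mul_inv_rev, hOut_mul]

theorem hOutHom_injective {r : ℕ} (hr : 1 ≤ r) : Function.Injective (hOutHom n r) :=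
  (injective_iff_map_eq_one _).2 fun _ h => inv_eq_one.1 (eq_one_of_hOut_eq_one hr h)

end OuterAutomorphisms

theorem mainTheorem2 (n : ℕ) [n.AtLeastTwo] :
    Nonempty (RF n ≃* SH n) ∧
    Nonempty (ShiftAut n ≃* HGroup n) ∧
    ∀ r : ℕ, 1 ≤ r → r < n →
      ∃ K : Subgroup (Out (HigmanThompson n r)), Nonempty (ShiftAut n ≃* K) := by
  have e : ShiftAut n ≃* HGroup n :=
    (MulEquiv.ofBijective (toShiftAut n) (toShiftAut_bijective n)).symm
  refine ⟨⟨(MulEquiv.ofBijective (biAct n) (biAct_bijective n)).symm⟩, ⟨e⟩, fun r hr _ => ?_⟩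
  exact ⟨(hOutHom n r).range,
    ⟨e.trans (MonoidHom.ofInjective (hOutHom_injective hr))⟩⟩
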